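/- **Setting.** Let $m_Q,m_r,L_r,L_c,g>0$, let $e_3$ be the upward unit vector of $\mathbb R^3$, $\hat a b=a\times b$, and $I_r=\tfrac23 m_rL_r$. The state consists of $x_r,v_r\in\mathbb R^3$ and of unit vectors $q_r,q_1,q_2$ with angular velocities $\omega_r\perp q_r$, $\omega_1\perp q_1$, $\omega_2\perp q_2$. Consider the disturbed reduced dynamics ($j=1,2$) $$\dot x_r=v_r,\qquad m_r(\dot v_r+ge_3)=\mu_1+\mu_2+\Delta x_r,$$ $$\dot q_r=\omega_r\times q_r,\qquad I_r\,\dot\omega_r=q_r\times(\mu_2-\mu_1)+\Delta q_r,$$ $$\dot q_j=\omega_j\times q_j,\qquad m_QL_c\,\dot\omega_j=m_Q\,q_j\times(\ddot x_r+(-1)^jL_r\ddot q_r+ge_3)-q_j\times u_j+\Delta q_j,$$ with disturbances that are bounded by given constants: $\|\Delta x_r\|\le\delta x_r$, $\|\Delta q_r\|\le\delta q_r$, $\|\Delta q_j\|\le\delta q_j$. **Reference.** The desired position $\tilde x_r$ and attitude $\tilde q_r$ with $\|\tilde q_r\|=1$ are $C^4$. Put $\tilde v_r=\dot{\tilde x}_r$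 and $\tilde\omega_r=\tilde q_r\times\dot{\tilde q}_r$, and suppose that $\dot{\tilde v}_r,\ddot{\tilde v}_r,\tilde\omega_r,\dot{\tilde\omega}_r,\ddot{\tilde\omega}_r$ are bounded on $[0,\infty)$. **Control law.** Let $e_{x_r}=x_r-\tilde x_r$, $e_{v_r}=v_r-\tilde v_r$ and, for $i\in\{r,1,2\}$, $e_{q_i}=\tilde q_i\times q_i$, $e_{\omega_i}=\omega_i+\hat q_i^2\tilde\omega_i$, $\Psi_i=1-\tilde q_i^Tq_i$. With positive gains, $\tilde\mu_1,\tilde\mu_2$ are given by $$\tilde\mu_1+\tilde\mu_2=m_r(\dot{\tilde v}_r+ge_3-k_{v_r}e_{v_r}-k_{x_r}e_{x_r}),$$ $$\tilde\mu_2-\tilde\mu_1=I_r\big[-\hat q_r\dot{\tilde\omega}_r+(q_r^T\tilde\omega_r)\hat q_r^2\tilde\omega_r-(q_r^T\tilde\omega_r)e_{\omega_r}+k_{\omega_r}\hat q_re_{\omega_r}+k_{q_r}\hat q_re_{q_r}\big],$$ and $\mu_j=(I+\hat q_j^2)\tilde\mu_j$, $\tilde q_j=-\tilde\mu_j/\|\tilde\mu_j\|$,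 $\tilde\omega_j=\tilde q_j\times\dot{\tilde q}_j$ (time derivatives along the motion). The thrust is $u_j=u_j^{\parallel}+u_j^{\perp}$, where, with $w^{\parallel_j}=(w^Tq_j)q_j$, $$u_j^{\parallel}=\mu_j+m_Q\big(\ddot x_r^{\parallel_j}+ge_3^{\parallel_j}+L_c\|\omega_j\|^2q_j+(-1)^jL_r\ddot q_r^{\parallel_j}\big),$$ $$u_j^{\perp}=-m_Q\hat q_j^2\big[\ddot x_r+(-1)^jL_r\ddot q_r+ge_3+L_c\hat q_j\dot{\tilde\omega}_j-L_c(q_j^T\tilde\omega_j)\omega_j\big]-m_QL_c\hat q_j\big[k_{q_j}e_{q_j}+k_{\omega_j}e_{\omega_j}\big].$$ A solution on an interval is a differentiable state curve satisfying these equations there, with $\tilde\mu_1,\tilde\mu_2\ne0$ and $\tilde\omega_1,\tilde\omega_2$ differentiable, so that the control law is defined. **Domain.** Fix $\bar e_{x_r},\bar e_{v_r},\bar e_{\omega_r},\bar e_{\omega_1},\bar e_{\omega_2}>0$ and $\psi_r\in(0,1)$. For $\psi_1,\psi_2\in(0,1)$ let $\mathcal D$ be the set of errors with $\|e_{x_r}\|\le\bar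 e_{x_r}$, $\|e_{v_r}\|\le\bar e_{v_r}$, $\|e_{\omega_i}\|\le\bar e_{\omega_i}$ and $\Psi_i\le\psi_i$ for $i\in\{r,1,2\}$, and let $\alpha=2\max_{j=1,2}\sqrt{\psi_j(2-\psi_j)}$. **Theorem.** For all the data above (other than $\psi_1,\psi_2$) there is $\alpha_{\max}>0$ such that for all $\psi_1,\psi_2\in(0,1)$ with $\alpha<\alpha_{\max}$ and every $b>0$ there are rod gains $k_{x_r},k_{v_r},k_{q_r},k_{\omega_r}>0$ such that for every $m_0>0$ there are cable gains $k_{q_1},k_{\omega_1},k_{q_2},k_{\omega_2}>0$ for which the tracking errors are uniformly ultimately bounded with ultimate bound $b$: there is $T\ge0$ such that for all $0\le t_0\le t_1$, all disturbances within the given bounds and every solution on $[t_0,t_1]$ that starts in $\mathcal D$ at time $t_0$ and satisfies $\|\tilde\mu_j(t)\|\ge m_0$ for $j=1,2$ and $t\in[t_0,t_1]$, $$\big\|\big(e_{x_r},e_{v_r},e_{q_r},e_{\omega_r},e_{q_1},e_{\omega_1},e_{q_2},e_{\omega_2}\big)(t)\big\|\le b\qquad\text{for all } t\in[t_0+T,t_1].$$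 -/

import Mathlib

noncomputable section

namespace RodTransport

open scoped InnerProductSpace

/-- Euclidean three-space. -/
abbrev E3 := EuclideanSpace ℝ (Fin 3)

/-- The cross product on Euclidean three-space; `cross q` is the hat map of `q`. -/
def cross (a b : E3) : E3 := WithLp.toLp 2 (crossProduct a.ofLp b.ofLp)

/-- The upward unit vector of the inertial frame. -/
def e3 : E3 := EuclideanSpace.single 2 1

/-- The component of `w` parallel to the unit vector `q`. -/
def par (q w : E3) : E3 := (⟪w, q⟫_ℝ) • q

/-- The sign `(-1) ^ j` for the cables `j = 1, 2`, which are indexed here by `0, 1 : Fin 2`. -/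
def sgn (j : Fin 2) : ℝ := if j = 0 then -1 else 1

/-- Physical constants: mass of a quadrotor, mass and half length of the rod, length of the cables,
gravitational acceleration. -/
structure Params where
  mQ : ℝ
  mr : ℝ
  Lr : ℝ
  Lc : ℝ
  g : ℝ
  mQ_pos : 0 < mQ
  mr_pos : 0 < mr
  Lr_pos : 0 < Lr
  Lc_pos : 0 < Lc
  g_pos : 0 < g

/-- Gains of the rod position and rod attitude loops. -/
structure RodGains where
  kx : ℝ
  kv : ℝ
  kq : ℝ
  kω : ℝ
  kx_pos : 0 < kx
  kv_pos : 0 < kv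
  kq_pos : 0 < kq
  kω_pos : 0 < kω

/-- Gains of the two cable attitude loops. -/
structure CableGains where
  kq : Fin 2 → ℝ
  kω : Fin 2 → ℝ
  kq_pos : ∀ j, 0 < kq j
  kω_pos : ∀ j, 0 < kω j

/-- Desired velocity of the rod for the desired position `xd`. -/
def velDes (xd : ℝ → E3) : ℝ → E3 := deriv xd

/-- Angular velocity of a curve `qd` on the unit sphere: the unique `w` with
`deriv qd = cross w qd` and `w` orthogonal to `qd`. -/
def angVel (qd : ℝ → E3) (t : ℝ) : E3 := cross (qd t) (deriv qd t)

/-- Desired position and attitude of the rod, with the bounds on the derivatives that make the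
desired accelerations, and the rate of change of the desired cable forces, bounded. -/
structure Reference where
  xd : ℝ → E3
  qd : ℝ → E3
  xd_smooth : ContDiff ℝ 4 xd
  qd_smooth : ContDiff ℝ 4 qd
  qd_unit : ∀ t, ‖qd t‖ = 1
  bounded : ∃ B : ℝ, ∀ t, 0 ≤ t →
    ‖deriv (velDes xd) t‖ ≤ B ∧ ‖deriv (deriv (velDes xd)) t‖ ≤ B ∧
    ‖angVel qd t‖ ≤ B ∧ ‖deriv (angVel qd) t‖ ≤ B ∧ ‖deriv (deriv (angVel qd)) t‖ ≤ B

/-- A curve of states: position and velocity of the rod, attitude and angular velocity of the rod,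
attitudes and angular velocities of the cables. -/
structure Motion where
  x : ℝ → E3
  v : ℝ → E3
  qr : ℝ → E3
  ωr : ℝ → E3
  q : Fin 2 → ℝ → E3
  ω : Fin 2 → ℝ → E3

/-- Disturbances acting on the rod position, rod attitude and cable attitude dynamics. -/
structure Disturbance where
  x : ℝ → E3
  qr : ℝ → E3
  q : Fin 2 → ℝ → E3

/-- Bounds for the disturbances. -/
structure DistBound where
  x : ℝ
  qr : ℝ
  q : Fin 2 → ℝ

/-- The disturbance obeys the bounds on the time set `J`. -/
def Disturbance.BoundedBy (d : Disturbance) (δ : DistBound) (J : Set ℝ) : Prop :=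
  ∀ t ∈ J, ‖d.x t‖ ≤ δ.x ∧ ‖d.qr t‖ ≤ δ.qr ∧ ∀ j, ‖d.q j t‖ ≤ δ.q j

section ControlLaw

variable (p : Params) (K : RodGains) (C : CableGains) (r : Reference) (s : Motion)

/-! ### Rod errors and desired cable forces -/

/-- Position error of the rod. -/
def ex (t : ℝ) : E3 := s.x t - r.xd t

/-- Velocity error of the rod. -/
def ev (t : ℝ) : E3 := s.v t - velDes r.xd t

/-- Attitude error of the rod. -/
def eqr (t : ℝ) : E3 := cross (r.qd t) (s.qr t)

/-- Angular velocity error of the rod. -/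
def eωr (t : ℝ) : E3 := s.ωr t + cross (s.qr t) (cross (s.qr t) (angVel r.qd t))

/-- Configuration error of the rod attitude. -/
def Ψr (t : ℝ) : ℝ := 1 - ⟪r.qd t, s.qr t⟫_ℝ

/-- The sum of the two desired cable forces. -/
def muSum (t : ℝ) : E3 :=
  p.mr • (deriv (velDes r.xd) t + p.g • e3 - K.kv • ev r s t - K.kx • ex r s t)

/-- The difference (second minus first) of the two desired cable forces. -/
def muDiff (t : ℝ) : E3 :=
  (2 / 3 * p.mr * p.Lr) •
    (-cross (s.qr t) (deriv (angVel r.qd) t)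
      + (⟪s.qr t, angVel r.qd t⟫_ℝ) • cross (s.qr t) (cross (s.qr t) (angVel r.qd t))
      - (⟪s.qr t, angVel r.qd t⟫_ℝ) • eωr r s t
      + K.kω • cross (s.qr t) (eωr r s t)
      + K.kq • cross (s.qr t) (eqr r s t))

/-- The desired cable forces. -/
def muDes (j : Fin 2) (t : ℝ) : E3 :=
  (1 / 2 : ℝ) • (muSum p K r s t + sgn j • muDiff p K r s t)

/-- The applied cable forces: the desired ones, projected onto the cables. -/
def mu (j : Fin 2) (t : ℝ) : E3 :=
  muDes p K r s j t + cross (s.q j t) (cross (s.q j t) (muDes p K r s j t))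

/-! ### Desired cable attitudes and cable errors along a motion on the time interval `J` -/

/-- The desired cable attitudes. -/
def qDes (j : Fin 2) (t : ℝ) : E3 := -(‖muDes p K r s j t‖⁻¹ • muDes p K r s j t)

/-- The angular velocities of the desired cable attitudes. -/
def ωDes (J : Set ℝ) (j : Fin 2) (t : ℝ) : E3 :=
  cross (qDes p K r s j t) (derivWithin (qDes p K r s j) J t)

/-- Attitude errors of the cables. -/
def eqc (j : Fin 2) (t : ℝ) : E3 := cross (qDes p K r s j t) (s.q j t)

/-- Angular velocity errors of the cables. -/
def eωc (J : Set ℝ) (j : Fin 2) (t : ℝ) : E3 :=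
  s.ω j t + cross (s.q j t) (cross (s.q j t) (ωDes p K r s J j t))

/-- Configuration errors of the cable attitudes. -/
def Ψ (j : Fin 2) (t : ℝ) : ℝ := 1 - ⟪qDes p K r s j t, s.q j t⟫_ℝ

/-! ### The thrusts -/

/-- Acceleration of the rod. -/
def accX (J : Set ℝ) (t : ℝ) : E3 := derivWithin s.v J t

/-- Second derivative of the rod attitude. -/
def accQr (J : Set ℝ) (t : ℝ) : E3 := derivWithin (derivWithin s.qr J) J t

/-- The component of the thrust parallel to the cable. -/
def uPar (J : Set ℝ) (j : Fin 2) (t : ℝ) : E3 :=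
  mu p K r s j t + p.mQ •
    (par (s.q j t) (accX s J t) + p.g • par (s.q j t) e3
      + (p.Lc * ‖s.ω j t‖ ^ 2) • s.q j t + (sgn j * p.Lr) • par (s.q j t) (accQr s J t))

/-- The component of the thrust perpendicular to the cable. -/
def uPerp (J : Set ℝ) (j : Fin 2) (t : ℝ) : E3 :=
  -(p.mQ • cross (s.q j t) (cross (s.q j t)
      (accX s J t + (sgn j * p.Lr) • accQr s J t + p.g • e3
        + p.Lc • cross (s.q j t) (derivWithin (ωDes p K r s J j) J t)
        - (p.Lc * ⟪s.q j t, ωDes p K r s J j t⟫_ℝ) • s.ω j t)))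
  - (p.mQ * p.Lc) • cross (s.q j t)
      (C.kq j • eqc p K r s j t + C.kω j • eωc p K r s J j t)

/-- The thrust of quadrotor `j`. -/
def thrust (J : Set ℝ) (j : Fin 2) (t : ℝ) : E3 :=
  uPar p K r s J j t + uPerp p K C r s J j t

/-- `s` is a solution on the time interval `J` of the reduced dynamics with disturbance `d`, in
closed loop with the control law. The desired cable forces do not vanish and the desired angular
velocities of the cables are differentiable, as the control law requires. -/
structure IsSolution (d : Disturbance) (J : Set ℝ) : Prop where
  qr_unit : ∀ t ∈ J, ‖s.qr t‖ = 1
  ωr_tangent : ∀ t ∈ J, ⟪s.ωr t, s.qr t⟫_ℝ = 0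
  q_unit : ∀ j, ∀ t ∈ J, ‖s.q j t‖ = 1
  ω_tangent : ∀ j, ∀ t ∈ J, ⟪s.ω j t, s.q j t⟫_ℝ = 0
  x_kin : ∀ t ∈ J, HasDerivWithinAt s.x (s.v t) J t
  v_diff : DifferentiableOn ℝ s.v J
  v_dyn : ∀ t ∈ J, p.mr • (derivWithin s.v J t + p.g • e3)
    = mu p K r s 0 t + mu p K r s 1 t + d.x t
  qr_kin : ∀ t ∈ J, HasDerivWithinAt s.qr (cross (s.ωr t) (s.qr t)) J t
  ωr_diff : DifferentiableOn ℝ s.ωr J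
  ωr_dyn : ∀ t ∈ J, (2 / 3 * p.mr * p.Lr) • derivWithin s.ωr J t
    = cross (s.qr t) (mu p K r s 1 t - mu p K r s 0 t) + d.qr t
  q_kin : ∀ j, ∀ t ∈ J, HasDerivWithinAt (s.q j) (cross (s.ω j t) (s.q j t)) J t
  ω_diff : ∀ j, DifferentiableOn ℝ (s.ω j) J
  ω_dyn : ∀ j, ∀ t ∈ J, (p.mQ * p.Lc) • derivWithin (s.ω j) J t
    = p.mQ • cross (s.q j t) (accX s J t + (sgn j * p.Lr) • accQr s J t + p.g • e3)
      - cross (s.q j t) (thrust p K C r s J j t) + d.q j t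
  muDes_ne : ∀ j, ∀ t ∈ J, muDes p K r s j t ≠ 0
  ωDes_diff : ∀ j, DifferentiableOn ℝ (ωDes p K r s J j) J

/-- The Euclidean norm of the vector of all tracking errors. -/
def errNorm (J : Set ℝ) (t : ℝ) : ℝ :=
  Real.sqrt (‖ex r s t‖ ^ 2 + ‖ev r s t‖ ^ 2 + ‖eqr r s t‖ ^ 2 + ‖eωr r s t‖ ^ 2
    + ∑ j, (‖eqc p K r s j t‖ ^ 2 + ‖eωc p K r s J j t‖ ^ 2))

/-- The bounds that define the domain of admissible errors, apart from the bounds on the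
configuration errors of the cables. -/
structure DomainBound where
  ex : ℝ
  ev : ℝ
  eωr : ℝ
  eω : Fin 2 → ℝ
  ψr : ℝ
  ex_pos : 0 < ex
  ev_pos : 0 < ev
  eωr_pos : 0 < eωr
  eω_pos : ∀ j, 0 < eω j
  ψr_pos : 0 < ψr
  ψr_lt : ψr < 1

/-- At time `t` the tracking errors lie in the domain given by the bounds `D` and `ψ`. -/
def InDomain (D : DomainBound) (ψ : Fin 2 → ℝ) (J : Set ℝ) (t : ℝ) : Prop :=
  ‖ex r s t‖ ≤ D.ex ∧ ‖ev r s t‖ ≤ D.ev ∧ ‖eωr r s t‖ ≤ D.eωr ∧ Ψr r s t ≤ D.ψr ∧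
  ∀ j, ‖eωc p K r s J j t‖ ≤ D.eω j ∧ Ψ p K r s j t ≤ ψ j

end ControlLaw

/-- The size `α` of the cable attitude errors that the bounds `ψ` on the configuration errors
allow. -/
def cableSize (ψ : Fin 2 → ℝ) : ℝ :=
  2 * max (Real.sqrt (ψ 0 * (2 - ψ 0))) (Real.sqrt (ψ 1 * (2 - ψ 1)))

/-- The tracking errors of the disturbed closed loop are uniformly ultimately bounded with ultimate
bound `b`, for initial errors in the domain given by `D` and `ψ`: after a time `T` that depends
neither on the initial time, nor on the initial state, nor on the disturbance, the error norm is at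
most `b`. Solutions are considered on `[t₀, t₁]` for every `t₁`, so this includes the solutions on
`[t₀, ∞)`. Only those solutions are considered along which the desired cable forces, whose
directions are the desired cable attitudes, have norm at least `m₀`. -/
def UniformlyUltimatelyBounded (p : Params) (K : RodGains) (C : CableGains) (r : Reference)
    (δ : DistBound) (D : DomainBound) (ψ : Fin 2 → ℝ) (m₀ b : ℝ) : Prop :=
  ∃ T : ℝ, 0 ≤ T ∧ ∀ (t₀ t₁ : ℝ) (s : Motion) (d : Disturbance), 0 ≤ t₀ →
    IsSolution p K C r s d (Set.Icc t₀ t₁) →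
    d.BoundedBy δ (Set.Icc t₀ t₁) →
    (∀ j, ∀ t ∈ Set.Icc t₀ t₁, m₀ ≤ ‖muDes p K r s j t‖) →
    InDomain p K r s D ψ (Set.Icc t₀ t₁) t₀ →
    ∀ t ∈ Set.Icc (t₀ + T) t₁, errNorm p K r s (Set.Icc t₀ t₁) t ≤ b

end RodTransport

end

noncomputable section

namespace RodTransport

open scoped InnerProductSpace

/-!
The rod gains `(k², 2 k)` and the cable gains `(κ², 2 κ)` make every error loop a perturbed second
order equation with the frequency `k` or `κ`, and the energy of such a loop decays exponentially to
a level that tends to `0` as the frequency grows. The energy of an attitude loop also controls the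
configuration error, so an attitude that starts within a right angle of the desired one stays away
from the antipode. Only the rod loops see the cables, through the directions of the cable forces:
the cable attitude error multiplies the desired forces. The cable loops are run so fast that the rod
hardly moves while the cables align with the desired forces; from then on the rod decays as if the
forces were exact.
-/

/-! ### The cross product -/

theorem inner_eq_dotProduct (a b : E3) : ⟪a, b⟫_ℝ = a.ofLp ⬝ᵥ b.ofLp := by
  simp [EuclideanSpace.inner_eq_star_dotProduct, dotProduct_comm]

theorem cross_swap (a b : E3) : cross a b = -cross b a := by
  simp only [cross, ← WithLp.toLp_neg, cross_anticomm]

theorem cross_self_eq_zero (a : E3) : cross a a = 0 := by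
  simp [cross]

theorem inner_cross_left_self (a b : E3) : ⟪cross a b, a⟫_ℝ = 0 := by
  simp [cross, inner_eq_dotProduct, dotProduct_comm]

theorem inner_cross_right_self (a b : E3) : ⟪cross a b, b⟫_ℝ = 0 := by
  simp [cross, inner_eq_dotProduct, dotProduct_comm]

theorem cross_cross_left (a b c : E3) :
    cross (cross a b) c = ⟪a, c⟫_ℝ • b - ⟪b, c⟫_ℝ • a := by
  simp [cross, inner_eq_dotProduct, cross_cross_eq_smul_sub_smul]

theorem cross_cross_right (a b c : E3) :
    cross a (cross b c) = ⟪a, c⟫_ℝ • b - ⟪a, b⟫_ℝ • c := by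
  simp [cross, inner_eq_dotProduct, cross_cross_eq_smul_sub_smul', dotProduct_comm]

theorem norm_cross_sq (a b : E3) : ‖cross a b‖ ^ 2 = ‖a‖ ^ 2 * ‖b‖ ^ 2 - ⟪a, b⟫_ℝ ^ 2 := by
  simp only [← real_inner_self_eq_norm_sq]
  simp only [inner_eq_dotProduct, cross, cross_dot_cross, dotProduct_comm b.ofLp a.ofLp, sq]

theorem norm_cross_le (a b : E3) : ‖cross a b‖ ≤ ‖a‖ * ‖b‖ := by
  refine (sq_le_sq₀ (norm_nonneg _) (by positivity)).1 ?_
  rw [norm_cross_sq, mul_pow]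
  exact sub_le_self _ (sq_nonneg _)

/-- The cross product as a continuous bilinear map, the source of its linearity and of its
product rule. -/
def crossCLM : E3 →L[ℝ] E3 →L[ℝ] E3 :=
  (LinearMap.mk₂ ℝ cross (by simp [cross]) (by simp [cross]) (by simp [cross])
    (by simp [cross])).mkContinuous₂ 1 fun a b =>
      (norm_cross_le a b).trans_eq (by rw [one_mul])

theorem cross_add_right (a b c : E3) : cross a (b + c) = cross a b + cross a c :=
  (crossCLM a).map_add b c

theorem cross_sub_right (a b c : E3) : cross a (b - c) = cross a b - cross a c :=
  (crossCLM a).map_sub b c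

theorem cross_smul_right (x : ℝ) (a b : E3) : cross a (x • b) = x • cross a b :=
  (crossCLM a).map_smul x b

theorem cross_neg_right (a b : E3) : cross a (-b) = -cross a b :=
  (crossCLM a).map_neg b

theorem hasDerivWithinAt_cross {f g : ℝ → E3} {f' g' : E3} {J : Set ℝ} {t : ℝ}
    (hf : HasDerivWithinAt f f' J t) (hg : HasDerivWithinAt g g' J t) :
    HasDerivWithinAt (fun t => cross (f t) (g t)) (cross (f t) g' + cross f' (g t)) J t :=
  crossCLM.hasDerivWithinAt_of_bilinear hf hg

theorem cross_cross_self_of_unit {q : E3} (hq : ‖q‖ = 1) (w : E3) :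
    cross q (cross q w) = ⟪q, w⟫_ℝ • q - w := by
  rw [cross_cross_right, real_inner_self_eq_norm_sq, hq, one_pow, one_smul]

theorem cross_cross_self_left_of_unit {q q' : E3} (hq : ‖q‖ = 1) (h : ⟪q, q'⟫_ℝ = 0) :
    cross (cross q q') q = q' := by
  rw [cross_cross_left, real_inner_self_eq_norm_sq, hq, real_inner_comm, h, one_pow, one_smul,
    zero_smul, sub_zero]

theorem inner_eq_zero_of_norm_eq_one {E : Type*} [NormedAddCommGroup E] [InnerProductSpace ℝ E]
    {q : ℝ → E} {q' : E} {J : Set ℝ} {t : ℝ} (ht : t ∈ J)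
    (hJ : UniqueDiffWithinAt ℝ J t) (hq : ∀ s ∈ J, ‖q s‖ = 1)
    (h : HasDerivWithinAt q q' J t) : ⟪q t, q'⟫_ℝ = 0 := by
  have hconst : HasDerivWithinAt (fun s => ‖q s‖ ^ 2) 0 J t :=
    (hasDerivWithinAt_const t J (1 : ℝ)).congr (fun s hs => by rw [hq s hs, one_pow])
      (by rw [hq t ht, one_pow])
  simpa using hJ.eq_deriv J h.norm_sq hconst

/-! ### Second order error systems -/

section Scalar

variable {a b : ℝ} {f : ℝ → ℝ}

theorem sub_le_mul_exp_of_deriv_le {c C : ℝ}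
    (hf : ∀ t ∈ Set.Icc a b, ∃ f', HasDerivWithinAt f f' (Set.Icc a b) t ∧ f' ≤ -c * (f t - C)) :
    ∀ t ∈ Set.Icc a b, f t - C ≤ (f a - C) * Real.exp (-c * (t - a)) := by
  choose! f' hderiv hle using hf
  have hbound := le_gronwallBound_of_liminf_deriv_right_le (f := fun t => f t - C) (f' := f')
    (δ := f a - C) (K := -c) (ε := 0)
    (fun t ht => ((hderiv t ht).sub_const C).continuousWithinAt)
    (fun t ht r hr => ?_) le_rfl
    (fun t ht => by simpa using hle t (Set.Ico_subset_Icc_self ht))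
  · simpa only [gronwallBound_ε0] using hbound
  · have hright : HasDerivWithinAt (fun t => f t - C) (f' t) (Set.Ici t) t :=
      ((hderiv t (Set.Ico_subset_Icc_self ht)).sub_const C).mono_of_mem_nhdsWithin
        (Filter.mem_of_superset (Icc_mem_nhdsGE ht.2) (Set.Icc_subset_Icc_left ht.1))
    simpa only [slope_def_field, inv_mul_eq_div] using hright.liminf_right_slope_le hr

theorem lt_of_continuousOn_of_bootstrap {M : ℝ} (hf : ContinuousOn f (Set.Icc a b))
    (ha : f a < M) (h : ∀ t ∈ Set.Icc a b, (∀ s ∈ Set.Icc a t, f s ≤ M) → f t < M) :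
    ∀ t ∈ Set.Icc a b, f t < M := by
  intro t ht
  by_contra! hMt
  obtain ⟨u, hu, hfu⟩ : ∃ u ∈ Set.Icc a t, f u = M :=
    intermediate_value_Icc ht.1 (hf.mono (Set.Icc_subset_Icc_right ht.2)) ⟨ha.le, hMt⟩
  have hclosed : IsClosed {s ∈ Set.Icc a b | M = f s} := by
    have := hf.preimage_isClosed_of_isClosed isClosed_Icc (isClosed_singleton (x := M))
    simpa only [Set.inter_def, Set.mem_preimage, Set.mem_singleton_iff, eq_comm] using this
  obtain ⟨s, ⟨hs, hMs⟩, hmin⟩ := (isCompact_Icc.of_isClosed_subset hclosed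
    (Set.sep_subset _ _)).exists_isLeast ⟨u, ⟨hu.1, hu.2.trans ht.2⟩, hfu.symm⟩
  refine (h s hs fun v hv => ?_).ne hMs.symm
  by_contra! hMv
  obtain ⟨w, hw, hfw⟩ : ∃ w ∈ Set.Icc a v, f w = M := intermediate_value_Icc hv.1
    (hf.mono (Set.Icc_subset_Icc_right (hv.2.trans hs.2))) ⟨ha.le, hMv.le⟩
  have hsw : s ≤ w := hmin ⟨⟨hw.1, hw.2.trans (hv.2.trans hs.2)⟩, hfw.symm⟩
  have hvw : v = w := le_antisymm (hv.2.trans hsw) hw.2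
  exact hMv.ne (hvw ▸ hfw.symm)

end Scalar

section SecondOrderError

variable {E : Type*} [NormedAddCommGroup E] [InnerProductSpace ℝ E]

/-- A configuration error `e` with potential `Ψ` and velocity error `v`, driven on the time set `J`
by critically damped feedback with gains `k ^ 2` and `2 * k`. The bound `D` is that of the
disturbance, and `B` accounts for the motion of the frame in which the errors are expressed. -/
structure SecondOrderError (k B D : ℝ) (J : Set ℝ) (Ψ : ℝ → ℝ) (e v : ℝ → E) : Prop where
  potential_deriv : ∀ t ∈ J, HasDerivWithinAt Ψ ⟪e t, v t⟫_ℝ J t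
  norm_sq_le : ∀ t ∈ J, ‖e t‖ ^ 2 ≤ 2 * Ψ t
  deriv : ∀ t ∈ J, ∃ e' v', HasDerivWithinAt e e' J t ∧ HasDerivWithinAt v v' J t ∧
    ⟪v t, v'⟫_ℝ ≤ -k ^ 2 * ⟪e t, v t⟫_ℝ - 2 * k * ‖v t‖ ^ 2 + D * ‖v t‖ ∧
    ⟪e t, v'⟫_ℝ + ⟪e', v t⟫_ℝ ≤ -k ^ 2 * ‖e t‖ ^ 2 - 2 * k * ⟪e t, v t⟫_ℝ + D * ‖e t‖
      + ‖v t‖ ^ 2 + B * (‖e t‖ * ‖v t‖)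

theorem SecondOrderError.mono {k B D : ℝ} {J J' : Set ℝ} {Ψ : ℝ → ℝ} {e v : ℝ → E}
    (h : SecondOrderError k B D J Ψ e v) (hJ : J' ⊆ J) : SecondOrderError k B D J' Ψ e v where
  potential_deriv t ht := (h.potential_deriv t (hJ ht)).mono hJ
  norm_sq_le t ht := h.norm_sq_le t (hJ ht)
  deriv t ht :=
    let ⟨e', v', he, hv, hvv, hev⟩ := h.deriv t (hJ ht)
    ⟨e', v', he.mono hJ, hv.mono hJ, hvv, hev⟩

theorem SecondOrderError.potential_nonneg {k B D : ℝ} {J : Set ℝ} {Ψ : ℝ → ℝ} {e v : ℝ → E}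
    (h : SecondOrderError k B D J Ψ e v) {t : ℝ} (ht : t ∈ J) : 0 ≤ Ψ t := by
  linarith [h.norm_sq_le t ht, sq_nonneg ‖e t‖]

/-- With `x = k ‖e‖`, `y = ‖v‖`, `s = k ⟪e, v⟫` and `P = k ^ 2 Ψ`, the left-hand side bounds the
derivative of the Lyapunov function `P + y ^ 2 / 2 + s / 2`. -/
theorem lyapunov_dissipation {k B D μ x y s P : ℝ} (hk : 0 < k) (hB : 4 * B ≤ k)
    (hμ : 0 < μ) (hμ1 : μ ≤ 1) (hs : |s| ≤ x * y) (hP : μ * P ≤ x ^ 2) :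
    -(k / 2) * x ^ 2 - k * s - 3 * k / 2 * y ^ 2 + D * y + D / 2 * x + B / 2 * (x * y)
      ≤ -(k * μ / 16) * (P + 1 / 2 * y ^ 2 + 1 / 2 * s) + 5 * D ^ 2 / k := by
  obtain ⟨hs_lower, hs_upper⟩ := abs_le.1 hs
  have hxy_nonneg : 0 ≤ x * y := (abs_nonneg s).trans hs
  have hxy : 2 * (x * y) ≤ x ^ 2 + y ^ 2 := by linarith [two_mul_le_add_sq x y]
  have hdamping : -(k / 2) * x ^ 2 - k * s - 3 * k / 2 * y ^ 2
      ≤ -(k / 4) * x ^ 2 - k / 2 * y ^ 2 := by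
    nlinarith [mul_nonneg hk.le (sq_nonneg (x / 2 - y)), mul_le_mul_of_nonneg_left hs_lower hk.le]
  have hframe : B / 2 * (x * y) ≤ k / 16 * (x ^ 2 + y ^ 2) := by
    linarith [mul_le_mul_of_nonneg_right hB hxy_nonneg, mul_le_mul_of_nonneg_left hxy hk.le]
  have hdisturbance : D * y + D / 2 * x ≤ k / 16 * (x ^ 2 + y ^ 2) + 5 * D ^ 2 / k := by
    have hy_young := two_mul_le_add_mul_sq (a := y) (b := D / 2) (show 0 < k / 16 by positivity)
    have hx_young := two_mul_le_add_mul_sq (a := x) (b := D / 4) (show 0 < k / 16 by positivity)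
    have hsum : (k / 16)⁻¹ * (D / 2) ^ 2 + (k / 16)⁻¹ * (D / 4) ^ 2 = 5 * D ^ 2 / k := by
      field_simp
      ring
    linarith
  have hlyapunov : μ * (P + 1 / 2 * y ^ 2 + 1 / 2 * s) ≤ 2 * (x ^ 2 + y ^ 2) := by
    nlinarith [mul_le_mul_of_nonneg_left hs_upper hμ.le, sq_nonneg y]
  nlinarith [mul_le_mul_of_nonneg_left hlyapunov hk.le]

variable {k B D μ a b : ℝ} {Ψ : ℝ → ℝ} {e v : ℝ → E}

theorem SecondOrderError.energy_le (h : SecondOrderError k B D (Set.Icc a b) Ψ e v) (hk : 0 < k)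
    (hB : 4 * B ≤ k) (hμ : 0 < μ) (hμ1 : μ ≤ 1)
    (hΨ : ∀ t ∈ Set.Icc a b, μ * Ψ t ≤ ‖e t‖ ^ 2) {t : ℝ} (ht : t ∈ Set.Icc a b) :
    1 / 2 * (k ^ 2 * Ψ t) + 1 / 4 * ‖v t‖ ^ 2
      ≤ (k ^ 2 * Ψ a + 1 / 2 * ‖v a‖ ^ 2 + k / 2 * (‖e a‖ * ‖v a‖))
          * Real.exp (-(k * μ / 16) * (t - a)) + 80 * D ^ 2 / (k ^ 2 * μ) := by
  set W : ℝ → ℝ := fun t => k ^ 2 * Ψ t + 1 / 2 * ‖v t‖ ^ 2 + k / 2 * ⟪e t, v t⟫_ℝ with hW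
  set C := 80 * D ^ 2 / (k ^ 2 * μ) with hC
  have hC_nonneg : 0 ≤ C := by positivity
  have hdecay := sub_le_mul_exp_of_deriv_le (f := W) (c := k * μ / 16) (C := C) (fun t ht => ?_)
    t ht
  · have hinit : W a ≤ k ^ 2 * Ψ a + 1 / 2 * ‖v a‖ ^ 2 + k / 2 * (‖e a‖ * ‖v a‖) := by
      simp only [hW]
      gcongr
      exact real_inner_le_norm _ _
    have hlower : 1 / 2 * (k ^ 2 * Ψ t) + 1 / 4 * ‖v t‖ ^ 2 ≤ W t := by
      have hinner : -(k * ‖e t‖ * ‖v t‖) ≤ k * ⟪e t, v t⟫_ℝ := by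
        nlinarith [neg_le_of_abs_le (abs_real_inner_le_norm (e t) (v t))]
      simp only [hW]
      nlinarith [sq_nonneg (k * ‖e t‖ - ‖v t‖),
        mul_le_mul_of_nonneg_left (h.norm_sq_le t ht) (sq_nonneg k)]
    have hexp := mul_le_mul_of_nonneg_right ((sub_le_self (W a) hC_nonneg).trans hinit)
      (Real.exp_pos (-(k * μ / 16) * (t - a))).le
    linarith
  · obtain ⟨e', v', he, hv, hvv, hev⟩ := h.deriv t ht
    refine ⟨_, (((h.potential_deriv t ht).const_mul (k ^ 2)).add
      (hv.norm_sq.const_mul (1 / 2))).add ((he.inner ℝ hv).const_mul (k / 2)), ?_⟩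
    have hinner : |k * ⟪e t, v t⟫_ℝ| ≤ k * ‖e t‖ * ‖v t‖ := by
      rw [abs_mul, abs_of_pos hk, mul_assoc]
      exact mul_le_mul_of_nonneg_left (abs_real_inner_le_norm _ _) hk.le
    have hpotential : μ * (k ^ 2 * Ψ t) ≤ (k * ‖e t‖) ^ 2 := by
      nlinarith [mul_le_mul_of_nonneg_left (hΨ t ht) (sq_nonneg k)]
    have hdissipation := lyapunov_dissipation (D := D) hk hB hμ hμ1 hinner hpotential
    have hCk : k * μ / 16 * C = 5 * D ^ 2 / k := by
      rw [hC]
      field_simp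
      ring
    simp only [hW]
    nlinarith [mul_le_mul_of_nonneg_left hev (half_pos hk).le]

/-- The bound on the squared errors of a critically damped loop with gain `k` at time `s` after its
start: an exponential of large amplitude and fast decay, plus the residual of the disturbance. -/
def envelope (κ k s : ℝ) : ℝ := κ * (k ^ 2 * Real.exp (-(s / κ) * k)) + κ / k ^ 2

theorem SecondOrderError.le_envelope {κ : ℝ}
    (h : SecondOrderError k B D (Set.Icc a b) Ψ e v) (hk : 1 ≤ k) (hB : 4 * B ≤ k)
    (hμ : 0 < μ) (hμ1 : μ ≤ 1) (hΨ : ∀ t ∈ Set.Icc a b, μ * Ψ t ≤ ‖e t‖ ^ 2)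
    (hinit : 4 * (k ^ 2 * Ψ a + 1 / 2 * ‖v a‖ ^ 2 + k / 2 * (‖e a‖ * ‖v a‖)) ≤ κ * k ^ 2)
    (hrate : 16 ≤ κ * μ) (hres : 320 * D ^ 2 ≤ κ * μ) :
    ∀ t ∈ Set.Icc a b, ‖e t‖ ^ 2 + ‖v t‖ ^ 2 ≤ envelope κ k (t - a) := by
  intro t ht
  have hk0 : 0 < k := one_pos.trans_le hk
  have hκ : 0 < κ := pos_of_mul_pos_left (by linarith) hμ.le
  have hpotential : ‖e t‖ ^ 2 ≤ 2 * (k ^ 2 * Ψ t) := by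
    linarith [h.norm_sq_le t ht,
      le_mul_of_one_le_left (h.potential_nonneg ht) (one_le_pow₀ (n := 2) hk)]
  have hexp : Real.exp (-(k * μ / 16) * (t - a)) ≤ Real.exp (-((t - a) / κ) * k) := by
    rw [Real.exp_le_exp, neg_mul, neg_mul, neg_le_neg_iff, div_mul_eq_mul_div, div_le_iff₀ hκ]
    nlinarith [mul_le_mul_of_nonneg_left hrate (mul_nonneg hk0.le (sub_nonneg.2 ht.1))]
  have hresidual : 4 * (80 * D ^ 2 / (k ^ 2 * μ)) ≤ κ / k ^ 2 := by
    rw [mul_div_assoc', div_le_div_iff₀ (by positivity) (by positivity)]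
    nlinarith [mul_le_mul_of_nonneg_left hres (sq_nonneg k)]
  calc ‖e t‖ ^ 2 + ‖v t‖ ^ 2
      ≤ 4 * (1 / 2 * (k ^ 2 * Ψ t) + 1 / 4 * ‖v t‖ ^ 2) := by linarith
    _ ≤ 4 * (k ^ 2 * Ψ a + 1 / 2 * ‖v a‖ ^ 2 + k / 2 * (‖e a‖ * ‖v a‖))
          * Real.exp (-(k * μ / 16) * (t - a)) + 4 * (80 * D ^ 2 / (k ^ 2 * μ)) := by
        linarith [h.energy_le hk0 hB hμ hμ1 hΨ ht]
    _ ≤ κ * k ^ 2 * Real.exp (-((t - a) / κ) * k) + κ / k ^ 2 := by gcongr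
    _ = envelope κ k (t - a) := by rw [envelope, mul_assoc]

theorem SecondOrderError.le_envelope_of_quadratic {X₀ Y₀ : ℝ}
    (h : SecondOrderError k B D (Set.Icc a b) Ψ e v) (hk : 1 ≤ k) (hB : 4 * B ≤ k)
    (hΨ : ∀ t ∈ Set.Icc a b, 2 * Ψ t = ‖e t‖ ^ 2) (he : ‖e a‖ ≤ X₀) (hv : ‖v a‖ ≤ Y₀) :
    ∀ t ∈ Set.Icc a b, ‖e t‖ ^ 2 + ‖v t‖ ^ 2
      ≤ envelope (4 * (X₀ ^ 2 + Y₀ ^ 2) + 16 + 320 * D ^ 2) k (t - a) := by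
  intro t ht
  refine h.le_envelope hk hB one_pos le_rfl (fun t ht => ?_) ?_ ?_ ?_ t ht
  · linarith [hΨ t ht, sq_nonneg ‖e t‖]
  · have he_sq : ‖e a‖ ^ 2 ≤ X₀ ^ 2 := by gcongr
    have hv_sq : ‖v a‖ ^ 2 ≤ Y₀ ^ 2 := by gcongr
    have hk_sq : 1 ≤ k ^ 2 := one_le_pow₀ hk
    have hcross : 2 * (k * (‖e a‖ * ‖v a‖)) ≤ k ^ 2 * ‖e a‖ ^ 2 + ‖v a‖ ^ 2 := by
      nlinarith [sq_nonneg (k * ‖e a‖ - ‖v a‖)]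
    have hΨa : 2 * (k ^ 2 * Ψ a) = k ^ 2 * ‖e a‖ ^ 2 := by
      rw [← hΨ a (Set.left_mem_Icc.2 (ht.1.trans ht.2))]
      ring
    nlinarith [mul_le_mul_of_nonneg_left he_sq (sq_nonneg k), sq_nonneg D,
      mul_le_mul_of_nonneg_left hv_sq (sq_nonneg k), sq_nonneg ‖v a‖, sq_nonneg ‖e a‖]
  · nlinarith [sq_nonneg X₀, sq_nonneg Y₀, sq_nonneg D]
  · nlinarith [sq_nonneg X₀, sq_nonneg Y₀]

theorem SecondOrderError.initial_energy_le_of_sphere {Y₀ ψ : ℝ}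
    (h : SecondOrderError k B D (Set.Icc a b) Ψ e v) (ha : a ∈ Set.Icc a b) (hk : 0 ≤ k)
    (hψ : ψ < 1) (hΨa : Ψ a ≤ ψ) (hv : ‖v a‖ ≤ Y₀) :
    k ^ 2 * Ψ a + 1 / 2 * ‖v a‖ ^ 2 + k / 2 * (‖e a‖ * ‖v a‖)
      ≤ k ^ 2 * ψ + 1 / 2 * Y₀ ^ 2 + k * Y₀ := by
  have he : ‖e a‖ ≤ 2 := by nlinarith [h.norm_sq_le a ha]
  calc k ^ 2 * Ψ a + 1 / 2 * ‖v a‖ ^ 2 + k / 2 * (‖e a‖ * ‖v a‖)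
      ≤ k ^ 2 * ψ + 1 / 2 * Y₀ ^ 2 + k / 2 * (2 * Y₀) := by gcongr
    _ = k ^ 2 * ψ + 1 / 2 * Y₀ ^ 2 + k * Y₀ := by ring

/-- The energy confines the trajectory to the sublevel set `Ψ < 1 + ψ`, which stays away from the
antipode `Ψ = 2`, where the configuration error vanishes too. -/
theorem SecondOrderError.potential_lt_of_sphere {Y₀ ψ : ℝ}
    (h : SecondOrderError k B D (Set.Icc a b) Ψ e v) (hk : 1 ≤ k) (hB : 4 * B ≤ k)
    (hψ : ψ < 1) (hgain : Y₀ ^ 2 + 2 * Y₀ + 160 * D ^ 2 / (1 - ψ) < (1 - ψ) * k)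
    (hΨ : ∀ t ∈ Set.Icc a b, ‖e t‖ ^ 2 = Ψ t * (2 - Ψ t)) (hΨa : Ψ a ≤ ψ) (hv : ‖v a‖ ≤ Y₀) :
    ∀ t ∈ Set.Icc a b, Ψ t < 1 + ψ := by
  intro t ht
  have ha : a ∈ Set.Icc a b := Set.left_mem_Icc.2 (ht.1.trans ht.2)
  refine lt_of_continuousOn_of_bootstrap
    (fun t ht => (h.potential_deriv t ht).continuousWithinAt) (by linarith [h.potential_nonneg ha])
    (fun u hu hle => ?_) t ht
  have hsub : Set.Icc a u ⊆ Set.Icc a b := Set.Icc_subset_Icc_right hu.2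
  have hμ : 0 < 1 - ψ := sub_pos.2 hψ
  have hk0 : 0 < k := one_pos.trans_le hk
  have hE := (h.mono hsub).energy_le hk0 hB hμ (by linarith [h.potential_nonneg ha])
    (fun t ht => by nlinarith [hΨ t (hsub ht), hle t ht, h.potential_nonneg (hsub ht)])
    (Set.right_mem_Icc.2 hu.1)
  have hinit := h.initial_energy_le_of_sphere ha hk0.le hψ hΨa hv
  have hexp : Real.exp (-(k * (1 - ψ) / 16) * (u - a)) ≤ 1 := by
    rw [Real.exp_le_one_iff, neg_mul, neg_nonpos]
    exact mul_nonneg (by positivity) (sub_nonneg.2 hu.1)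
  have hinit_nonneg : 0 ≤ k ^ 2 * Ψ a + 1 / 2 * ‖v a‖ ^ 2 + k / 2 * (‖e a‖ * ‖v a‖) := by
    have hΨa_nonneg := h.potential_nonneg ha
    positivity
  have hres : 80 * D ^ 2 / (k ^ 2 * (1 - ψ)) ≤ 80 * D ^ 2 / (1 - ψ) := by
    gcongr
    exact le_mul_of_one_le_left hμ.le (one_le_pow₀ hk)
  have hscaled : k ^ 2 * Ψ u < k ^ 2 * (1 + ψ) := by
    have hsum : 1 / 2 * Y₀ ^ 2 + k * Y₀ + 80 * D ^ 2 / (1 - ψ) < 1 / 2 * ((1 - ψ) * k ^ 2) := by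
      have hres_le : 80 * D ^ 2 / (1 - ψ) ≤ k * (80 * D ^ 2 / (1 - ψ)) :=
        le_mul_of_one_le_left (by positivity) hk
      have h160 : 160 * D ^ 2 / (1 - ψ) = 2 * (80 * D ^ 2 / (1 - ψ)) := by ring
      nlinarith [mul_lt_mul_of_pos_left hgain hk0, sq_nonneg Y₀]
    nlinarith [mul_le_of_le_one_right hinit_nonneg hexp, sq_nonneg ‖v u‖]
  exact lt_of_mul_lt_mul_left hscaled (sq_nonneg k)

theorem SecondOrderError.le_envelope_of_sphere {Y₀ ψ : ℝ}
    (h : SecondOrderError k B D (Set.Icc a b) Ψ e v) (hk : 1 ≤ k) (hB : 4 * B ≤ k)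
    (hψ : ψ < 1) (hgain : Y₀ ^ 2 + 2 * Y₀ + 160 * D ^ 2 / (1 - ψ) < (1 - ψ) * k)
    (hΨ : ∀ t ∈ Set.Icc a b, ‖e t‖ ^ 2 = Ψ t * (2 - Ψ t)) (hΨa : Ψ a ≤ ψ) (hv : ‖v a‖ ≤ Y₀) :
    ∀ t ∈ Set.Icc a b, ‖e t‖ ^ 2 + ‖v t‖ ^ 2
      ≤ envelope ((16 + 320 * D ^ 2) / (1 - ψ)) k (t - a) := by
  intro t ht
  have ha : a ∈ Set.Icc a b := Set.left_mem_Icc.2 (ht.1.trans ht.2)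
  have hμ : 0 < 1 - ψ := sub_pos.2 hψ
  have hconfined := h.potential_lt_of_sphere hk hB hψ hgain hΨ hΨa hv
  have hκμ : (16 + 320 * D ^ 2) / (1 - ψ) * (1 - ψ) = 16 + 320 * D ^ 2 :=
    div_mul_cancel₀ _ hμ.ne'
  have hκ : 16 ≤ (16 + 320 * D ^ 2) / (1 - ψ) := by
    rw [le_div_iff₀ hμ]
    nlinarith [h.potential_nonneg ha, sq_nonneg D]
  refine h.le_envelope hk hB hμ (by linarith [h.potential_nonneg ha])
    (fun t ht => by nlinarith [hΨ t ht, hconfined t ht, h.potential_nonneg ht]) ?_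
    (by nlinarith [sq_nonneg D]) (by linarith) t ht
  have hres : 0 ≤ 160 * D ^ 2 / (1 - ψ) := by positivity
  have hinit := h.initial_energy_le_of_sphere ha (zero_le_one.trans hk) hψ hΨa hv
  calc 4 * (k ^ 2 * Ψ a + 1 / 2 * ‖v a‖ ^ 2 + k / 2 * (‖e a‖ * ‖v a‖))
      ≤ 4 * (k ^ 2 * ψ + 1 / 2 * Y₀ ^ 2 + k * Y₀) := by linarith
    _ ≤ 16 * k ^ 2 := by
        have hYk : Y₀ ^ 2 + 2 * Y₀ ≤ k := by nlinarith [h.potential_nonneg ha]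
        nlinarith [mul_le_mul_of_nonneg_left hYk (zero_le_one.trans hk),
          mul_le_mul_of_nonneg_right hk (sq_nonneg Y₀),
          mul_le_mul_of_nonneg_right hψ.le (sq_nonneg k)]
    _ ≤ (16 + 320 * D ^ 2) / (1 - ψ) * k ^ 2 := by gcongr

end SecondOrderError

section Envelope

variable {κ k : ℝ}

theorem envelope_antitone (hκ : 0 < κ) (hk : 0 < k) : Antitone (envelope κ k) := by
  intro s s' hs
  unfold envelope
  gcongr

theorem tendsto_envelope_of_time (hκ : 0 < κ) (hk : 0 < k) :
    Filter.Tendsto (envelope κ k) Filter.atTop (nhds (κ / k ^ 2)) := by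
  have hexponent : Filter.Tendsto (fun s => -(s / κ) * k) Filter.atTop Filter.atBot :=
    (Filter.tendsto_neg_atTop_atBot.comp
      (Filter.tendsto_id.atTop_div_const hκ)).atBot_mul_const hk
  unfold envelope
  simpa using (((Real.tendsto_exp_atBot.comp hexponent).const_mul (k ^ 2)).const_mul κ).add_const
    (κ / k ^ 2)

theorem tendsto_envelope_of_gain (hκ : 0 < κ) {τ : ℝ} (hτ : 0 < τ) :
    Filter.Tendsto (fun k => envelope κ k τ) Filter.atTop (nhds 0) := by
  have hexp : Filter.Tendsto (fun k : ℝ => k ^ 2 * Real.exp (-(τ / κ) * k)) Filter.atTop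
      (nhds 0) := by
    simpa only [Real.rpow_two] using
      tendsto_rpow_mul_exp_neg_mul_atTop_nhds_zero 2 (τ / κ) (div_pos hτ hκ)
  simpa [envelope] using (hexp.const_mul κ).add
    (Filter.Tendsto.const_div_atTop (Filter.tendsto_pow_atTop two_ne_zero) κ)

end Envelope

/-! ### Attitude loops on the sphere -/

theorem inner_cross_permutation (a b c : E3) : ⟪a, cross b c⟫_ℝ = ⟪b, cross c a⟫_ℝ := by
  simp only [inner_eq_dotProduct, cross]
  exact triple_product_permutation _ _ _

/-- The angular velocity error of an attitude `q` with angular velocity `ω`, relative to the desired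
angular velocity `ωd`. The errors `eωr` of the rod and `eωc` of the cables are instances. -/
def angErr (q ω ωd : E3) : E3 := ω + cross q (cross q ωd)

section AngErr

variable {q ω : E3}

theorem angErr_eq (hq : ‖q‖ = 1) (ω ωd : E3) : angErr q ω ωd = ω - ωd + ⟪q, ωd⟫_ℝ • q := by
  rw [angErr, cross_cross_self_of_unit hq]
  module

theorem inner_angErr_self (hω : ⟪ω, q⟫_ℝ = 0) (ωd : E3) : ⟪angErr q ω ωd, q⟫_ℝ = 0 := by
  rw [angErr, inner_add_left, hω, inner_cross_left_self, add_zero]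

theorem norm_cross_cross_le (hq : ‖q‖ = 1) (w : E3) : ‖cross q (cross q w)‖ ≤ ‖cross q w‖ := by
  simpa only [hq, one_mul] using norm_cross_le q (cross q w)

theorem abs_inner_tangent_le {e : E3} (hq : ‖q‖ = 1) (he : ⟪e, q⟫_ℝ = 0) (qd : E3) :
    |⟪qd, e⟫_ℝ| ≤ ‖cross qd q‖ * ‖e‖ := by
  have hproj : ⟪qd, e⟫_ℝ = -⟪cross q (cross q qd), e⟫_ℝ := by
    rw [cross_cross_self_of_unit hq, inner_sub_left, real_inner_smul_left, real_inner_comm e q, he]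
    ring
  rw [hproj, abs_neg]
  refine (abs_real_inner_le_norm _ _).trans ?_
  gcongr
  rw [cross_swap qd q, norm_neg]
  exact norm_cross_cross_le hq qd

theorem inner_attErr_angErr (hq : ‖q‖ = 1) (qd ω ωd : E3) :
    ⟪cross qd q, angErr q ω ωd⟫_ℝ = -(⟪qd, cross ω q⟫_ℝ + ⟪cross ωd qd, q⟫_ℝ) := by
  rw [angErr_eq hq, inner_add_right, inner_sub_right, real_inner_smul_right,
    inner_cross_right_self, inner_cross_permutation qd, cross_swap q qd, inner_neg_right,
    real_inner_comm q, inner_cross_permutation q, real_inner_comm ω, real_inner_comm ωd]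
  ring

theorem inner_deriv_attErr_angErr (hq : ‖q‖ = 1) (hω : ⟪ω, q⟫_ℝ = 0) (qd ωd : E3) :
    ⟪cross qd (cross ω q) + cross (cross ωd qd) q, angErr q ω ωd⟫_ℝ
      = ⟪ωd, q⟫_ℝ * ⟪qd, angErr q ω ωd⟫_ℝ + ⟪qd, q⟫_ℝ * ‖angErr q ω ωd‖ ^ 2 := by
  have htangent : ⟪q, angErr q ω ωd⟫_ℝ = 0 := by
    rw [real_inner_comm, inner_angErr_self hω]
  have hsq : ‖angErr q ω ωd‖ ^ 2 = ⟪ω, angErr q ω ωd⟫_ℝ - ⟪ωd, angErr q ω ωd⟫_ℝ := by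
    rw [← real_inner_self_eq_norm_sq, ← inner_sub_left]
    nth_rewrite 1 [angErr_eq hq]
    rw [inner_add_left, real_inner_smul_left, htangent, mul_zero, add_zero]
  rw [hsq, cross_cross_left, cross_cross_right]
  simp only [inner_add_left, inner_sub_left, real_inner_smul_left, htangent]
  ring

end AngErr

/-- An attitude `q` with angular velocity `ω` that tracks `qd` with angular velocity `ωd` on the
time set `J`, with gains `k ^ 2` and `2 * k`. The bound `B` is that of `ωd`, and `D` that of the
disturbance `d`. The term with coefficient `σ` does no work on the angular velocity error. -/
structure AttitudeLoop (k B D : ℝ) (J : Set ℝ) (q qd ω ωd : ℝ → E3) : Prop where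
  q_unit : ∀ t ∈ J, ‖q t‖ = 1
  qd_unit : ∀ t ∈ J, ‖qd t‖ = 1
  ω_tangent : ∀ t ∈ J, ⟪ω t, q t⟫_ℝ = 0
  q_kin : ∀ t ∈ J, HasDerivWithinAt q (cross (ω t) (q t)) J t
  qd_kin : ∀ t ∈ J, HasDerivWithinAt qd (cross (ωd t) (qd t)) J t
  ωd_le : ∀ t ∈ J, ‖ωd t‖ ≤ B
  dyn : ∀ t ∈ J, ∃ (ωd' d : E3) (σ : ℝ), HasDerivWithinAt ωd ωd' J t ∧ ‖d‖ ≤ D ∧ |σ| ≤ 2 * B ∧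
    HasDerivWithinAt ω (-cross (q t) (cross (q t) ωd') + ⟪q t, ωd t⟫_ℝ • cross (q t) (ω t)
      + cross (q t) (cross (q t)
          (k ^ 2 • cross (qd t) (q t) + (2 * k) • angErr (q t) (ω t) (ωd t)))
      + d + σ • cross (q t) (angErr (q t) (ω t) (ωd t))) J t

namespace AttitudeLoop

variable {k B D : ℝ} {J : Set ℝ} {q qd ω ωd : ℝ → E3} {t : ℝ}

theorem norm_attErr_sq (h : AttitudeLoop k B D J q qd ω ωd) (ht : t ∈ J) :
    ‖cross (qd t) (q t)‖ ^ 2 = (1 - ⟪qd t, q t⟫_ℝ) * (2 - (1 - ⟪qd t, q t⟫_ℝ)) := by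
  rw [norm_cross_sq, h.q_unit t ht, h.qd_unit t ht]
  ring

theorem exists_hasDerivWithinAt_angErr (h : AttitudeLoop k B D J q qd ω ωd) (ht : t ∈ J) :
    ∃ (d : E3) (σ c : ℝ), ‖d‖ ≤ D ∧ |σ| ≤ 2 * B ∧
      HasDerivWithinAt (fun t => angErr (q t) (ω t) (ωd t))
        (-(k ^ 2 • cross (qd t) (q t)) - (2 * k) • angErr (q t) (ω t) (ωd t) + d
          + σ • cross (q t) (angErr (q t) (ω t) (ωd t)) + c • q t) J t := by
  obtain ⟨ωd', d, σ, hωd, hd, hσ, hω⟩ := h.dyn t ht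
  have hderiv := (hω.sub hωd).add (((h.q_kin t ht).inner ℝ hωd).smul (h.q_kin t ht))
  refine ⟨d, σ, ⟪q t, k ^ 2 • cross (qd t) (q t) + (2 * k) • angErr (q t) (ω t) (ωd t)⟫_ℝ
    + ⟪cross (ω t) (q t), ωd t⟫_ℝ, hd, hσ, (hderiv.congr (fun s hs => angErr_eq (h.q_unit s hs) _ _)
    (angErr_eq (h.q_unit t ht) _ _)).congr_deriv ?_⟩
  rw [cross_cross_self_of_unit (h.q_unit t ht), cross_cross_self_of_unit (h.q_unit t ht),
    cross_swap (q t) (ω t)]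
  module

theorem inner_angErr_deriv_le (h : AttitudeLoop k B D J q qd ω ωd) (ht : t ∈ J) {d : E3} (σ c : ℝ)
    (hd : ‖d‖ ≤ D) :
    ⟪angErr (q t) (ω t) (ωd t), -(k ^ 2 • cross (qd t) (q t))
        - (2 * k) • angErr (q t) (ω t) (ωd t) + d
        + σ • cross (q t) (angErr (q t) (ω t) (ωd t)) + c • q t⟫_ℝ
      ≤ -k ^ 2 * ⟪cross (qd t) (q t), angErr (q t) (ω t) (ωd t)⟫_ℝ
        - 2 * k * ‖angErr (q t) (ω t) (ωd t)‖ ^ 2 + D * ‖angErr (q t) (ω t) (ωd t)‖ := by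
  have htangent := inner_angErr_self (h.ω_tangent t ht) (ωd t)
  set e := cross (qd t) (q t)
  set v := angErr (q t) (ω t) (ωd t)
  have hgyro : ⟪v, cross (q t) v⟫_ℝ = 0 := by rw [real_inner_comm, inner_cross_right_self]
  have hdist : ⟪v, d⟫_ℝ ≤ D * ‖v‖ := by
    rw [mul_comm]
    exact (real_inner_le_norm v d).trans (by gcongr)
  simp only [inner_add_right, inner_sub_right, inner_neg_right, real_inner_smul_right,
    real_inner_self_eq_norm_sq, htangent, hgyro, real_inner_comm e v]
  linarith

theorem inner_attErr_deriv_le (h : AttitudeLoop k B D J q qd ω ωd) (ht : t ∈ J) {d : E3} {σ : ℝ}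
    (c : ℝ) (hd : ‖d‖ ≤ D) (hσ : |σ| ≤ 2 * B) :
    ⟪cross (qd t) (q t), -(k ^ 2 • cross (qd t) (q t))
        - (2 * k) • angErr (q t) (ω t) (ωd t) + d
        + σ • cross (q t) (angErr (q t) (ω t) (ωd t)) + c • q t⟫_ℝ
      ≤ -k ^ 2 * ‖cross (qd t) (q t)‖ ^ 2
        - 2 * k * ⟪cross (qd t) (q t), angErr (q t) (ω t) (ωd t)⟫_ℝ + D * ‖cross (qd t) (q t)‖
        + 2 * B * (‖cross (qd t) (q t)‖ * ‖angErr (q t) (ω t) (ωd t)‖) := by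
  have htangent := inner_cross_right_self (qd t) (q t)
  set e := cross (qd t) (q t)
  set v := angErr (q t) (ω t) (ωd t)
  have hgyro : σ * ⟪e, cross (q t) v⟫_ℝ ≤ 2 * B * (‖e‖ * ‖v‖) := by
    refine (le_abs_self _).trans ?_
    rw [abs_mul]
    refine mul_le_mul hσ ?_ (abs_nonneg _) ((abs_nonneg σ).trans hσ)
    refine (abs_real_inner_le_norm _ _).trans ?_
    gcongr
    simpa only [h.q_unit t ht, one_mul] using norm_cross_le (q t) v
  have hdist : ⟪e, d⟫_ℝ ≤ D * ‖e‖ := by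
    rw [mul_comm]
    exact (real_inner_le_norm e d).trans (by gcongr)
  simp only [inner_add_right, inner_sub_right, inner_neg_right, real_inner_smul_right,
    real_inner_self_eq_norm_sq, htangent]
  linarith

theorem inner_deriv_attErr_le (h : AttitudeLoop k B D J q qd ω ωd) (ht : t ∈ J) :
    ⟪cross (qd t) (cross (ω t) (q t)) + cross (cross (ωd t) (qd t)) (q t),
        angErr (q t) (ω t) (ωd t)⟫_ℝ
      ≤ ‖angErr (q t) (ω t) (ωd t)‖ ^ 2
        + B * (‖cross (qd t) (q t)‖ * ‖angErr (q t) (ω t) (ωd t)‖) := by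
  have htangent := inner_angErr_self (h.ω_tangent t ht) (ωd t)
  have hq := h.q_unit t ht
  rw [inner_deriv_attErr_angErr hq (h.ω_tangent t ht), add_comm]
  refine add_le_add (mul_le_of_le_one_left (sq_nonneg _) ?_) ((le_abs_self _).trans ?_)
  · simpa only [hq, h.qd_unit t ht, one_mul] using real_inner_le_norm (qd t) (q t)
  · rw [abs_mul]
    refine mul_le_mul ?_ (abs_inner_tangent_le hq htangent _) (abs_nonneg _)
      ((norm_nonneg _).trans (h.ωd_le t ht))
    refine (abs_real_inner_le_norm _ _).trans ?_
    rw [hq, mul_one]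
    exact h.ωd_le t ht

theorem secondOrderError (h : AttitudeLoop k B D J q qd ω ωd) :
    SecondOrderError k (3 * B) D J (fun t => 1 - ⟪qd t, q t⟫_ℝ)
      (fun t => cross (qd t) (q t)) (fun t => angErr (q t) (ω t) (ωd t)) where
  potential_deriv t ht := by
    rw [inner_attErr_angErr (h.q_unit t ht)]
    exact ((h.qd_kin t ht).inner ℝ (h.q_kin t ht)).const_sub 1
  norm_sq_le t ht := by
    rw [h.norm_attErr_sq ht]
    linarith [sq_nonneg (1 - ⟪qd t, q t⟫_ℝ)]
  deriv t ht := by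
    obtain ⟨d, σ, c, hd, hσ, hderiv⟩ := h.exists_hasDerivWithinAt_angErr ht
    refine ⟨_, _, hasDerivWithinAt_cross (h.qd_kin t ht) (h.q_kin t ht), hderiv,
      h.inner_angErr_deriv_le ht σ c hd, ?_⟩
    linarith [h.inner_attErr_deriv_le ht c hd hσ, h.inner_deriv_attErr_le ht]

end AttitudeLoop

theorem exists_envelope_attitudeLoop {ψ : ℝ} (hψ : ψ < 1) (Y₀ B D : ℝ) :
    ∃ κ > 0, ∀ᶠ k in Filter.atTop, ∀ (a b : ℝ) (q qd ω ωd : ℝ → E3),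
      AttitudeLoop k B D (Set.Icc a b) q qd ω ωd →
      ‖angErr (q a) (ω a) (ωd a)‖ ≤ Y₀ → 1 - ⟪qd a, q a⟫_ℝ ≤ ψ →
      ∀ t ∈ Set.Icc a b, ‖cross (qd t) (q t)‖ ^ 2 + ‖angErr (q t) (ω t) (ωd t)‖ ^ 2
        ≤ envelope κ k (t - a) := by
  have hμ : 0 < 1 - ψ := sub_pos.2 hψ
  refine ⟨(16 + 320 * D ^ 2) / (1 - ψ), by positivity, ?_⟩
  filter_upwards [Filter.eventually_ge_atTop 1, Filter.eventually_ge_atTop (4 * (3 * B)),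
    Filter.eventually_gt_atTop ((Y₀ ^ 2 + 2 * Y₀ + 160 * D ^ 2 / (1 - ψ)) / (1 - ψ))]
    with k hk hB hgain a b q qd ω ωd h hY hΨ
  exact h.secondOrderError.le_envelope_of_sphere hk hB hψ ((div_lt_iff₀' hμ).1 hgain)
    (fun t ht => h.norm_attErr_sq ht) hΨ hY

/-! ### Linear loops -/

theorem exists_envelope_linearLoop {E : Type*} [NormedAddCommGroup E] [InnerProductSpace ℝ E]
    (X₀ Y₀ D : ℝ) :
    ∃ κ > 0, ∀ k, 1 ≤ k → ∀ (a b : ℝ) (x v : ℝ → E),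
      (∀ t ∈ Set.Icc a b, HasDerivWithinAt x (v t) (Set.Icc a b) t) →
      (∀ t ∈ Set.Icc a b, ∃ d, ‖d‖ ≤ D ∧
        HasDerivWithinAt v (-((2 * k) • v t) - k ^ 2 • x t + d) (Set.Icc a b) t) →
      ‖x a‖ ≤ X₀ → ‖v a‖ ≤ Y₀ →
      ∀ t ∈ Set.Icc a b, ‖x t‖ ^ 2 + ‖v t‖ ^ 2 ≤ envelope κ k (t - a) := by
  refine ⟨4 * (X₀ ^ 2 + Y₀ ^ 2) + 16 + 320 * D ^ 2, by positivity, ?_⟩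
  intro k hk a b x v hx hv hX hY
  have hloop : SecondOrderError k 0 D (Set.Icc a b) (fun t => 1 / 2 * ‖x t‖ ^ 2) x v := by
    refine ⟨fun t ht => ?_, fun t _ => by linarith, fun t ht => ?_⟩
    · exact ((hx t ht).norm_sq.const_mul (1 / 2)).congr_deriv (by ring)
    · obtain ⟨d, hd, hderiv⟩ := hv t ht
      have hdist : ∀ w : E, ⟪w, d⟫_ℝ ≤ D * ‖w‖ := fun w => by
        rw [mul_comm]
        exact (real_inner_le_norm w d).trans (by gcongr)
      refine ⟨_, _, hx t ht, hderiv, ?_, ?_⟩ <;>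
        simp only [inner_add_right, inner_sub_right, inner_neg_right, real_inner_smul_right,
          real_inner_self_eq_norm_sq, real_inner_comm (x t) (v t)]
      · linarith [hdist (v t)]
      · linarith [hdist (x t)]
  exact hloop.le_envelope_of_quadratic hk (by linarith) (fun t _ => by ring) hX hY

/-! ### Regularity of the reference -/

theorem Reference.hasDerivAt_xd (r : Reference) (t : ℝ) : HasDerivAt r.xd (velDes r.xd t) t :=
  (r.xd_smooth.differentiable (by norm_num) t).hasDerivAt

theorem Reference.contDiff_velDes (r : Reference) : ContDiff ℝ 3 (velDes r.xd) :=
  ((contDiff_succ_iff_deriv (n := 3)).1 (by simpa using! r.xd_smooth)).2.2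

theorem Reference.hasDerivAt_velDes (r : Reference) (t : ℝ) :
    HasDerivAt (velDes r.xd) (deriv (velDes r.xd) t) t :=
  (r.contDiff_velDes.differentiable (by norm_num) t).hasDerivAt

theorem Reference.hasDerivAt_deriv_velDes (r : Reference) (t : ℝ) :
    HasDerivAt (deriv (velDes r.xd)) (deriv (deriv (velDes r.xd)) t) t :=
  (((contDiff_succ_iff_deriv (n := 2)).1 (by simpa using! r.contDiff_velDes)).2.2.differentiable
    (by norm_num) t).hasDerivAt

theorem Reference.contDiff_angVel (r : Reference) : ContDiff ℝ 3 (angVel r.qd) :=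
  (crossCLM.contDiff.comp (r.qd_smooth.of_le (by norm_num))).clm_apply
    ((contDiff_succ_iff_deriv (n := 3)).1 (by simpa using! r.qd_smooth)).2.2

theorem Reference.hasDerivAt_angVel (r : Reference) (t : ℝ) :
    HasDerivAt (angVel r.qd) (deriv (angVel r.qd) t) t :=
  (r.contDiff_angVel.differentiable (by norm_num) t).hasDerivAt

theorem Reference.hasDerivAt_deriv_angVel (r : Reference) (t : ℝ) :
    HasDerivAt (deriv (angVel r.qd)) (deriv (deriv (angVel r.qd)) t) t :=
  (((contDiff_succ_iff_deriv (n := 2)).1 (by simpa using! r.contDiff_angVel)).2.2.differentiable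
    (by norm_num) t).hasDerivAt

theorem Reference.hasDerivAt_qd (r : Reference) (t : ℝ) :
    HasDerivAt r.qd (cross (angVel r.qd t) (r.qd t)) t := by
  have hderiv := (r.qd_smooth.differentiable (by norm_num) t).hasDerivAt
  have horth : ⟪r.qd t, deriv r.qd t⟫_ℝ = 0 :=
    inner_eq_zero_of_norm_eq_one (Set.mem_univ t) uniqueDiffWithinAt_univ
      (fun s _ => r.qd_unit s) hderiv.hasDerivWithinAt
  rwa [angVel, cross_cross_self_left_of_unit (r.qd_unit t) horth]

/-! ### Closed loop of the rod -/

/-- The deviation of the applied cable force `mu` from the desired one `muDes`, through which the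
cable attitude errors act on the rod. -/
def muErr (p : Params) (K : RodGains) (r : Reference) (s : Motion) (j : Fin 2) (t : ℝ) : E3 :=
  cross (s.q j t) (cross (s.q j t) (muDes p K r s j t))

theorem muDes_add (p : Params) (K : RodGains) (r : Reference) (s : Motion) (t : ℝ) :
    muDes p K r s 0 t + muDes p K r s 1 t = muSum p K r s t := by
  simp only [muDes, sgn, if_pos, one_ne_zero, if_false]
  module

theorem muDes_sub (p : Params) (K : RodGains) (r : Reference) (s : Motion) (t : ℝ) :
    muDes p K r s 1 t - muDes p K r s 0 t = muDiff p K r s t := by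
  simp only [muDes, sgn, if_pos, one_ne_zero, if_false]
  module

section Loops

variable {p : Params} {K : RodGains} {C : CableGains} {r : Reference} {s : Motion}
  {d : Disturbance} {J : Set ℝ} {j : Fin 2} {t : ℝ}

theorem norm_muErr_le (hq : ‖s.q j t‖ = 1) (hμ : muDes p K r s j t ≠ 0) :
    ‖muErr p K r s j t‖ ≤ ‖muDes p K r s j t‖ * ‖eqc p K r s j t‖ := by
  have hpolar : muDes p K r s j t = -(‖muDes p K r s j t‖ • qDes p K r s j t) := by
    rw [qDes, smul_neg, neg_neg, smul_smul, mul_inv_cancel₀ (norm_ne_zero_iff.2 hμ), one_smul]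
  refine (norm_cross_cross_le hq _).trans_eq ?_
  nth_rewrite 1 [hpolar]
  rw [cross_neg_right, cross_smul_right, norm_neg, norm_smul, norm_norm, cross_swap, norm_neg, eqc]

theorem IsSolution.hasDerivWithinAt_ex (h : IsSolution p K C r s d J) (ht : t ∈ J) :
    HasDerivWithinAt (ex r s) (ev r s t) J t :=
  (h.x_kin t ht).sub (r.hasDerivAt_xd t).hasDerivWithinAt

theorem IsSolution.hasDerivWithinAt_ev (h : IsSolution p K C r s d J) (ht : t ∈ J) :
    HasDerivWithinAt (ev r s) (-(K.kv • ev r s t) - K.kx • ex r s t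
      + p.mr⁻¹ • (muErr p K r s 0 t + muErr p K r s 1 t + d.x t)) J t := by
  refine ((h.v_diff t ht).hasDerivWithinAt.sub
    (r.hasDerivAt_velDes t).hasDerivWithinAt).congr_deriv ?_
  refine smul_right_injective E3 p.mr_pos.ne' ?_
  have hforce : mu p K r s 0 t + mu p K r s 1 t
      = muSum p K r s t + (muErr p K r s 0 t + muErr p K r s 1 t) := by
    rw [← muDes_add, mu, mu, muErr, muErr]
    abel
  have hdyn := h.v_dyn t ht
  rw [hforce, muSum, smul_add, ← eq_sub_iff_add_eq] at hdyn
  simp only [smul_sub, hdyn, smul_add, smul_neg, smul_inv_smul₀ p.mr_pos.ne']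
  abel

/-- The disturbance of the rod attitude loop. The last term arises because the term
`-⟪qr, angVel qd⟫ • eωr` of the control law reverses the sign of the gyroscopic term of an
`AttitudeLoop`. -/
def rodDist (p : Params) (K : RodGains) (r : Reference) (s : Motion) (d : Disturbance) (t : ℝ) :
    E3 :=
  (2 / 3 * p.mr * p.Lr)⁻¹ • (cross (s.qr t) (muErr p K r s 1 t - muErr p K r s 0 t) + d.qr t)
    + (2 * ⟪s.qr t, angVel r.qd t⟫_ℝ) • cross (angVel r.qd t) (s.qr t)

theorem IsSolution.derivWithin_ωr (h : IsSolution p K C r s d J) (ht : t ∈ J) :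
    derivWithin s.ωr J t = -cross (s.qr t) (cross (s.qr t) (deriv (angVel r.qd) t))
      - ⟪s.qr t, angVel r.qd t⟫_ℝ • cross (s.qr t) (s.ωr t)
      + cross (s.qr t) (cross (s.qr t) (K.kq • eqr r s t + K.kω • eωr r s t))
      + (2 / 3 * p.mr * p.Lr)⁻¹ • (cross (s.qr t) (muErr p K r s 1 t - muErr p K r s 0 t)
        + d.qr t) := by
  have hI : 2 / 3 * p.mr * p.Lr ≠ 0 := by
    have hmr := p.mr_pos
    have hLr := p.Lr_pos
    positivity
  have hforce : mu p K r s 1 t - mu p K r s 0 t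
      = muDiff p K r s t + (muErr p K r s 1 t - muErr p K r s 0 t) := by
    rw [← muDes_sub, mu, mu, muErr, muErr]
    abel
  refine smul_right_injective E3 hI ?_
  have hdyn := h.ωr_dyn t ht
  rw [hforce, cross_add_right, muDiff, cross_smul_right] at hdyn
  have hω : s.ωr t = eωr r s t - cross (s.qr t) (cross (s.qr t) (angVel r.qd t)) := by
    rw [eωr, add_sub_cancel_right]
  simp only [hdyn, smul_add (2 / 3 * p.mr * p.Lr), smul_inv_smul₀ hI]
  rw [hω]
  simp only [cross_add_right, cross_sub_right, cross_neg_right, cross_smul_right]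
  module

theorem IsSolution.attitudeLoop_rod (h : IsSolution p K C r s d J) {k B D : ℝ} {J' : Set ℝ}
    (hkq : K.kq = k ^ 2) (hkω : K.kω = 2 * k) (hJ : J' ⊆ J)
    (hB : ∀ t ∈ J', ‖angVel r.qd t‖ ≤ B) (hD : ∀ t ∈ J', ‖rodDist p K r s d t‖ ≤ D) :
    AttitudeLoop k B D J' s.qr r.qd s.ωr (angVel r.qd) where
  q_unit t ht := h.qr_unit t (hJ ht)
  qd_unit t _ := r.qd_unit t
  ω_tangent t ht := h.ωr_tangent t (hJ ht)
  q_kin t ht := (h.qr_kin t (hJ ht)).mono hJ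
  qd_kin t _ := (r.hasDerivAt_qd t).hasDerivWithinAt
  ωd_le := hB
  dyn t ht := by
    have hq := h.qr_unit t (hJ ht)
    refine ⟨_, rodDist p K r s d t, -(2 * ⟪s.qr t, angVel r.qd t⟫_ℝ),
      (r.hasDerivAt_angVel t).hasDerivWithinAt, hD t ht, ?_,
      ((h.ωr_diff t (hJ ht)).hasDerivWithinAt.mono hJ).congr_deriv ?_⟩
    · rw [abs_neg, abs_mul, abs_two]
      gcongr
      refine (abs_real_inner_le_norm _ _).trans ?_
      rw [hq, one_mul]
      exact hB t ht
    · have hgyro : cross (s.qr t) (angErr (s.qr t) (s.ωr t) (angVel r.qd t))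
          = cross (s.qr t) (s.ωr t) + cross (angVel r.qd t) (s.qr t) := by
        rw [angErr_eq hq, cross_add_right, cross_sub_right, cross_smul_right, cross_self_eq_zero,
          cross_swap (s.qr t) (angVel r.qd t)]
        module
      rw [h.derivWithin_ωr (hJ ht), hgyro, rodDist, hkq, hkω]
      change _ = -cross (s.qr t) (cross (s.qr t) (deriv (angVel r.qd) t))
        + _ + cross (s.qr t) (cross (s.qr t) (k ^ 2 • eqr r s t + (2 * k) • eωr r s t)) + _ + _
      module

/-! ### Closed loops of the cables -/

theorem hasDerivWithinAt_neg_inv_norm_smul {E : Type*} [NormedAddCommGroup E]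
    [InnerProductSpace ℝ E] {f : ℝ → E} {f' : E} (hf : HasDerivWithinAt f f' J t) (h0 : f t ≠ 0) :
    ∃ g', HasDerivWithinAt (fun t => -(‖f t‖⁻¹ • f t)) g' J t ∧ ‖g'‖ ≤ 2 * ‖f'‖ / ‖f t‖ := by
  have hpos : 0 < ‖f t‖ := norm_pos_iff.2 h0
  have hnorm : HasDerivWithinAt (fun t => ‖f t‖) (⟪f t, f'⟫_ℝ / ‖f t‖) J t := by
    have hsqrt := hf.norm_sq.sqrt (pow_ne_zero 2 hpos.ne')
    simp only [Real.sqrt_sq (norm_nonneg _)] at hsqrt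
    exact hsqrt.congr_deriv (by field_simp)
  refine ⟨_, ((hnorm.inv hpos.ne').smul hf).neg, ?_⟩
  rw [norm_neg]
  calc ‖‖f t‖⁻¹ • f' + (-(⟪f t, f'⟫_ℝ / ‖f t‖) / ‖f t‖ ^ 2) • f t‖
      ≤ ‖f t‖⁻¹ * ‖f'‖ + ‖⟪f t, f'⟫_ℝ‖ / ‖f t‖ / ‖f t‖ ^ 2 * ‖f t‖ := by
        refine (norm_add_le _ _).trans_eq ?_
        simp only [norm_smul, norm_inv, norm_norm, norm_div, norm_neg, norm_pow]
    _ ≤ ‖f t‖⁻¹ * ‖f'‖ + ‖f t‖ * ‖f'‖ / ‖f t‖ / ‖f t‖ ^ 2 * ‖f t‖ := by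
        gcongr
        exact norm_inner_le_norm _ _
    _ = 2 * ‖f'‖ / ‖f t‖ := by
        field_simp
        ring

theorem norm_qDes (h : muDes p K r s j t ≠ 0) : ‖qDes p K r s j t‖ = 1 := by
  rw [qDes, norm_neg, norm_smul, norm_inv, norm_norm, inv_mul_cancel₀ (norm_ne_zero_iff.2 h)]

theorem IsSolution.hasDerivWithinAt_qDes (h : IsSolution p K C r s d J) (ht : t ∈ J)
    (hJ : UniqueDiffWithinAt ℝ J t) {M m₀ : ℝ} {μ' : E3} (hm₀ : 0 < m₀)
    (hμ : HasDerivWithinAt (muDes p K r s j) μ' J t) (hM : ‖μ'‖ ≤ M)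
    (hμ_ge : m₀ ≤ ‖muDes p K r s j t‖) :
    HasDerivWithinAt (qDes p K r s j) (cross (ωDes p K r s J j t) (qDes p K r s j t)) J t ∧
      ‖ωDes p K r s J j t‖ ≤ 2 * M / m₀ := by
  obtain ⟨g', hg, hg_le⟩ := hasDerivWithinAt_neg_inv_norm_smul hμ (h.muDes_ne j t ht)
  change HasDerivWithinAt (qDes p K r s j) g' J t at hg
  have hunit : ∀ t ∈ J, ‖qDes p K r s j t‖ = 1 := fun t ht => norm_qDes (h.muDes_ne j t ht)
  have horth := inner_eq_zero_of_norm_eq_one ht hJ hunit hg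
  rw [ωDes, hg.derivWithin hJ, cross_cross_self_left_of_unit (hunit t ht) horth]
  refine ⟨hg, (norm_cross_le _ _).trans ?_⟩
  have hM0 : 0 ≤ M := (norm_nonneg _).trans hM
  rw [hunit t ht, one_mul]
  exact hg_le.trans (by gcongr)

theorem cross_uPar (hq : ‖s.q j t‖ = 1) : cross (s.q j t) (uPar p K r s J j t) = 0 := by
  simp only [uPar, mu, par, cross_cross_self_of_unit hq, add_sub_cancel, cross_add_right,
    cross_smul_right, cross_self_eq_zero, smul_zero, add_zero]

theorem IsSolution.derivWithin_ω (h : IsSolution p K C r s d J) (ht : t ∈ J) :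
    derivWithin (s.ω j) J t =
      -cross (s.q j t) (cross (s.q j t) (derivWithin (ωDes p K r s J j) J t))
      + ⟪s.q j t, ωDes p K r s J j t⟫_ℝ • cross (s.q j t) (s.ω j t)
      + cross (s.q j t) (cross (s.q j t) (C.kq j • eqc p K r s j t + C.kω j • eωc p K r s J j t))
      + (p.mQ * p.Lc)⁻¹ • d.q j t := by
  have hI : p.mQ * p.Lc ≠ 0 := (mul_pos p.mQ_pos p.Lc_pos).ne'
  have hq := h.q_unit j t ht
  have hcube (w : E3) : cross (s.q j t) (cross (s.q j t) (cross (s.q j t) w))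
      = -cross (s.q j t) w := by
    rw [cross_cross_self_of_unit hq, real_inner_comm, inner_cross_left_self, zero_smul, zero_sub]
  refine smul_right_injective E3 hI ?_
  simp only [h.ω_dyn j t ht, thrust, cross_add_right, cross_uPar hq, zero_add, uPerp,
    cross_sub_right, cross_neg_right, cross_smul_right, hcube, smul_add, smul_inv_smul₀ hI]
  module

theorem IsSolution.attitudeLoop_cable (h : IsSolution p K C r s d J) {k B D : ℝ} {J' : Set ℝ}
    (hkq : C.kq j = k ^ 2) (hkω : C.kω j = 2 * k) (hJ : J' ⊆ J)
    (hqd : ∀ t ∈ J',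
      HasDerivWithinAt (qDes p K r s j) (cross (ωDes p K r s J j t) (qDes p K r s j t)) J t ∧
        ‖ωDes p K r s J j t‖ ≤ B)
    (hD : ∀ t ∈ J', ‖(p.mQ * p.Lc)⁻¹ • d.q j t‖ ≤ D) :
    AttitudeLoop k B D J' (s.q j) (qDes p K r s j) (s.ω j) (ωDes p K r s J j) where
  q_unit t ht := h.q_unit j t (hJ ht)
  qd_unit t ht := norm_qDes (h.muDes_ne j t (hJ ht))
  ω_tangent t ht := h.ω_tangent j t (hJ ht)
  q_kin t ht := (h.q_kin j t (hJ ht)).mono hJ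
  qd_kin t ht := (hqd t ht).1.mono hJ
  ωd_le t ht := (hqd t ht).2
  dyn t ht := by
    refine ⟨_, _, 0, (h.ωDes_diff j t (hJ ht)).hasDerivWithinAt.mono hJ, hD t ht, ?_,
      ((h.ω_diff j t (hJ ht)).hasDerivWithinAt.mono hJ).congr_deriv ?_⟩
    · rw [abs_zero]
      exact mul_nonneg two_pos.le ((norm_nonneg _).trans (hqd t ht).2)
    · rw [h.derivWithin_ω (hJ ht), zero_smul, add_zero, hkq, hkω]
      rfl

end Loops

/-! ### Uniform bounds along the motion of the rod -/

/-- At `t` the curve `f` is differentiable within `J`, and `M` bounds its value and derivative. -/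
def C1Bound {E : Type*} [NormedAddCommGroup E] [NormedSpace ℝ E] (M : ℝ) (f : ℝ → E) (J : Set ℝ)
    (t : ℝ) : Prop :=
  ∃ f', HasDerivWithinAt f f' J t ∧ ‖f t‖ ≤ M ∧ ‖f'‖ ≤ M

theorem eventually_c1Bound_comp {Z E : Type*} [NormedAddCommGroup Z] [NormedSpace ℝ Z]
    [ProperSpace Z] [NormedAddCommGroup E] [NormedSpace ℝ E] {F : Z → E} (hF : ContDiff ℝ 1 F)
    (R : ℝ) :
    ∀ᶠ M in Filter.atTop, ∀ {z : ℝ → Z} {J : Set ℝ} {t : ℝ},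
      C1Bound R z J t → C1Bound M (fun t => F (z t)) J t := by
  obtain ⟨M₀, hM₀⟩ :=
    (isCompact_closedBall (0 : Z) R).exists_bound_of_continuousOn hF.continuous.continuousOn
  obtain ⟨M₁, hM₁⟩ := (isCompact_closedBall (0 : Z) R).exists_bound_of_continuousOn
    (hF.continuous_fderiv one_ne_zero).continuousOn
  filter_upwards [Filter.eventually_ge_atTop M₀, Filter.eventually_ge_atTop (M₁ * R)]
    with M hM hM' z J t ⟨z', hz, hzt, hz'⟩
  have hball := mem_closedBall_zero_iff.2 hzt
  refine ⟨_, (hF.differentiable one_ne_zero (z t)).hasFDerivAt.comp_hasDerivWithinAt t hz,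
    (hM₀ _ hball).trans hM, ((fderiv ℝ F (z t)).le_of_opNorm_le (hM₁ _ hball) z').trans ?_⟩
  exact (mul_le_mul_of_nonneg_left hz' ((norm_nonneg _).trans (hM₁ _ hball))).trans hM'

@[fun_prop]
theorem contDiff_cross {X : Type*} [NormedAddCommGroup X] [NormedSpace ℝ X] {n : WithTop ℕ∞}
    {f g : X → E3} (hf : ContDiff ℝ n f) (hg : ContDiff ℝ n g) :
    ContDiff ℝ n (fun x => cross (f x) (g x)) :=
  (crossCLM.contDiff.comp hf).clm_apply hg

/-- The quantities on which the rod errors and the desired cable forces depend: errors and state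
of the rod, and derivatives of the reference. -/
inductive RodCoord
  | ex | ev | ωr | qr | qd | ωd | αd | ad
  deriving DecidableEq

instance : Fintype RodCoord :=
  Fintype.ofList [.ex, .ev, .ωr, .qr, .qd, .ωd, .αd, .ad] (by rintro (_ | _) <;> simp)

/-- The values of the coordinates `RodCoord` along a motion: `αd` stands for the desired angular
acceleration, and `ad` for the desired acceleration. -/
def rodCoords (r : Reference) (s : Motion) (t : ℝ) : RodCoord → E3
  | .ex => ex r s t
  | .ev => ev r s t
  | .ωr => s.ωr t
  | .qr => s.qr t
  | .qd => r.qd t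
  | .ωd => angVel r.qd t
  | .αd => deriv (angVel r.qd) t
  | .ad => deriv (velDes r.xd) t

theorem exists_contDiff_muDes (p : Params) (K : RodGains) (j : Fin 2) :
    ∃ F : (RodCoord → E3) → E3, ContDiff ℝ 1 F ∧
      ∀ r s t, muDes p K r s j t = F (rodCoords r s t) := by
  have hinner : ContDiff ℝ 1 fun z : RodCoord → E3 => ⟪z .qr, z .ωd⟫_ℝ :=
    (contDiff_apply ℝ E3 RodCoord.qr).inner ℝ (contDiff_apply ℝ E3 RodCoord.ωd)
  refine ⟨fun z => (1 / 2 : ℝ) • (p.mr • (z .ad + p.g • e3 - K.kv • z .ev - K.kx • z .ex)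
    + sgn j • (2 / 3 * p.mr * p.Lr) • (-cross (z .qr) (z .αd)
      + ⟪z .qr, z .ωd⟫_ℝ • cross (z .qr) (cross (z .qr) (z .ωd))
      - ⟪z .qr, z .ωd⟫_ℝ • (z .ωr + cross (z .qr) (cross (z .qr) (z .ωd)))
      + K.kω • cross (z .qr) (z .ωr + cross (z .qr) (cross (z .qr) (z .ωd)))
      + K.kq • cross (z .qr) (cross (z .qd) (z .qr)))), ?_, fun r s t => rfl⟩
  fun_prop

/-- The squared norm of the vector of the tracking errors of the rod. -/
def rodErrSq (r : Reference) (s : Motion) (t : ℝ) : ℝ :=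
  ‖ex r s t‖ ^ 2 + ‖ev r s t‖ ^ 2 + ‖eqr r s t‖ ^ 2 + ‖eωr r s t‖ ^ 2

section RodBounds

variable {p : Params} {K : RodGains} {C : CableGains} {r : Reference} {s : Motion}
  {d : Disturbance} {δ : DistBound} {J : Set ℝ} {t R B M : ℝ}

theorem norm_rodCoords_le (hq : ‖s.qr t‖ = 1) (had : ‖deriv (velDes r.xd) t‖ ≤ B)
    (hωd : ‖angVel r.qd t‖ ≤ B) (hαd : ‖deriv (angVel r.qd) t‖ ≤ B) (hR : rodErrSq r s t ≤ R) :
    ‖rodCoords r s t‖ ≤ R + 1 + B := by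
  have hB := (norm_nonneg _).trans hωd
  have hR0 : 0 ≤ R := le_trans (by unfold rodErrSq; positivity) hR
  rw [rodErrSq] at hR
  rw [pi_norm_le_iff_of_nonneg (by positivity)]
  rintro (_ | _) <;> simp only [rodCoords]
  · nlinarith [sq_nonneg (‖ex r s t‖ - 1)]
  · nlinarith [sq_nonneg (‖ev r s t‖ - 1)]
  · have hωr : s.ωr t = eωr r s t - cross (s.qr t) (cross (s.qr t) (angVel r.qd t)) := by
      rw [eωr, add_sub_cancel_right]
    have hproj : ‖cross (s.qr t) (cross (s.qr t) (angVel r.qd t))‖ ≤ B := by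
      refine (norm_cross_cross_le hq _).trans ((norm_cross_le _ _).trans ?_)
      rwa [hq, one_mul]
    have heω : ‖eωr r s t‖ ≤ R + 1 := by nlinarith [sq_nonneg (‖eωr r s t‖ - 1)]
    rw [hωr]
    exact norm_sub_le_of_le heω hproj
  · linarith
  · linarith [r.qd_unit t]
  all_goals linarith

theorem norm_mu_le {j : Fin 2} (hq : ‖s.q j t‖ = 1) :
    ‖mu p K r s j t‖ ≤ ‖muDes p K r s j t‖ := by
  rw [mu, cross_cross_self_of_unit hq, add_sub_cancel, norm_smul, hq, mul_one]
  simpa only [hq, one_mul] using norm_inner_le_norm (𝕜 := ℝ) (s.q j t) (muDes p K r s j t)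

theorem IsSolution.norm_derivWithin_v_le (h : IsSolution p K C r s d J) (hd : d.BoundedBy δ J)
    (ht : t ∈ J) (hM : ∀ j, ‖muDes p K r s j t‖ ≤ M) :
    ‖derivWithin s.v J t‖ ≤ p.mr⁻¹ * (M + M + δ.x) + p.g * ‖e3‖ := by
  have hmr := p.mr_pos
  have hmu (j : Fin 2) := (norm_mu_le (h.q_unit j t ht)).trans (hM j)
  have hacc : derivWithin s.v J t
      = p.mr⁻¹ • (mu p K r s 0 t + mu p K r s 1 t + d.x t) - p.g • e3 := by
    rw [← h.v_dyn t ht, inv_smul_smul₀ hmr.ne', add_sub_cancel_right]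
  rw [hacc]
  refine norm_sub_le_of_le ?_ ?_
  · rw [norm_smul_of_nonneg (inv_nonneg.2 hmr.le)]
    gcongr
    exact norm_add_le_of_le (norm_add_le_of_le (hmu 0) (hmu 1)) (hd t ht).1
  · rw [norm_smul_of_nonneg p.g_pos.le]

theorem IsSolution.norm_derivWithin_ωr_le (h : IsSolution p K C r s d J) (hd : d.BoundedBy δ J)
    (ht : t ∈ J) (hM : ∀ j, ‖muDes p K r s j t‖ ≤ M) :
    ‖derivWithin s.ωr J t‖ ≤ (2 / 3 * p.mr * p.Lr)⁻¹ * (M + M + δ.qr) := by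
  have hI : 0 < 2 / 3 * p.mr * p.Lr := by
    have hmr := p.mr_pos
    have hLr := p.Lr_pos
    positivity
  have hmu (j : Fin 2) := (norm_mu_le (h.q_unit j t ht)).trans (hM j)
  rw [← inv_smul_smul₀ hI.ne' (derivWithin s.ωr J t), h.ωr_dyn t ht,
    norm_smul_of_nonneg (inv_nonneg.2 hI.le)]
  gcongr
  refine norm_add_le_of_le ((norm_cross_le _ _).trans ?_) (hd t ht).2.1
  rw [h.qr_unit t ht, one_mul]
  exact norm_sub_le_of_le (hmu 1) (hmu 0)

/-- The derivative of `rodCoords r s` along a motion. -/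
def rodCoordsDeriv (r : Reference) (s : Motion) (J : Set ℝ) (t : ℝ) : RodCoord → E3
  | .ex => ev r s t
  | .ev => derivWithin s.v J t - deriv (velDes r.xd) t
  | .ωr => derivWithin s.ωr J t
  | .qr => cross (s.ωr t) (s.qr t)
  | .qd => cross (angVel r.qd t) (r.qd t)
  | .ωd => deriv (angVel r.qd) t
  | .αd => deriv (deriv (angVel r.qd)) t
  | .ad => deriv (deriv (velDes r.xd)) t

theorem IsSolution.hasDerivWithinAt_rodCoords (h : IsSolution p K C r s d J) (ht : t ∈ J) :
    HasDerivWithinAt (rodCoords r s) (rodCoordsDeriv r s J t) J t := by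
  rw [hasDerivWithinAt_pi]
  rintro (_ | _)
  · exact h.hasDerivWithinAt_ex ht
  · exact (h.v_diff t ht).hasDerivWithinAt.sub (r.hasDerivAt_velDes t).hasDerivWithinAt
  · exact (h.ωr_diff t ht).hasDerivWithinAt
  · exact h.qr_kin t ht
  · exact (r.hasDerivAt_qd t).hasDerivWithinAt
  · exact (r.hasDerivAt_angVel t).hasDerivWithinAt
  · exact (r.hasDerivAt_deriv_angVel t).hasDerivWithinAt
  · exact (r.hasDerivAt_deriv_velDes t).hasDerivWithinAt

theorem exists_bound_muDes (p : Params) (K : RodGains) (R : ℝ) :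
    ∃ M : ℝ, ∀ r s t, ‖rodCoords r s t‖ ≤ R → ∀ j, ‖muDes p K r s j t‖ ≤ M := by
  choose F hF hmuDes using exists_contDiff_muDes p K
  obtain ⟨M, hM⟩ :=
    (isCompact_closedBall (0 : RodCoord → E3) R).exists_bound_of_continuousOn
      (continuous_pi fun j => (hF j).continuous).continuousOn
  refine ⟨M, fun r s t hR j => ?_⟩
  rw [hmuDes]
  exact (norm_le_pi_norm (fun j => F j (rodCoords r s t)) j).trans
    (hM _ (mem_closedBall_zero_iff.2 hR))

theorem exists_c1Bound_rodCoords (p : Params) (K : RodGains) (r : Reference) (δ : DistBound)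
    (R : ℝ) :
    ∃ M : ℝ, ∀ C s d J t, IsSolution p K C r s d J → d.BoundedBy δ J → t ∈ J → 0 ≤ t →
      rodErrSq r s t ≤ R → C1Bound M (rodCoords r s) J t := by
  obtain ⟨B, hB⟩ := r.bounded
  set M₀ := R + 1 + B
  obtain ⟨M₁, hM₁⟩ := exists_bound_muDes p K M₀
  set Mv := p.mr⁻¹ * (M₁ + M₁ + δ.x) + p.g * ‖e3‖
  set Mω := (2 / 3 * p.mr * p.Lr)⁻¹ * (M₁ + M₁ + δ.qr)
  refine ⟨M₀ + M₀ * M₀ + B + Mv + Mω, fun C s d J t h hd ht ht0 hR => ?_⟩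
  obtain ⟨had, had', hωd, hαd, hαd'⟩ := hB t ht0
  have hM₀ : ‖rodCoords r s t‖ ≤ M₀ := norm_rodCoords_le (h.qr_unit t ht) had hωd hαd hR
  have hcoord (c : RodCoord) : ‖rodCoords r s t c‖ ≤ M₀ := (norm_le_pi_norm _ c).trans hM₀
  have hMv : ‖derivWithin s.v J t‖ ≤ Mv := h.norm_derivWithin_v_le hd ht (hM₁ r s t hM₀)
  have hMω : ‖derivWithin s.ωr J t‖ ≤ Mω := h.norm_derivWithin_ωr_le hd ht (hM₁ r s t hM₀)
  have hB0 := (norm_nonneg _).trans had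
  have hM₀0 := (norm_nonneg _).trans hM₀
  have hMv0 := (norm_nonneg _).trans hMv
  have hMω0 := (norm_nonneg _).trans hMω
  have hsq : 0 ≤ M₀ * M₀ := mul_nonneg hM₀0 hM₀0
  have hcross (c c' : RodCoord) : ‖cross (rodCoords r s t c) (rodCoords r s t c')‖ ≤ M₀ * M₀ :=
    (norm_cross_le _ _).trans (by gcongr <;> exact hcoord _)
  refine ⟨_, h.hasDerivWithinAt_rodCoords ht, by linarith, ?_⟩
  rw [pi_norm_le_iff_of_nonneg (by positivity)]
  rintro (_ | _) <;> simp only [rodCoordsDeriv]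
  · linarith [show ‖ev r s t‖ ≤ M₀ from hcoord .ev]
  · linarith [norm_sub_le_of_le hMv had]
  · linarith
  · linarith [show ‖cross (s.ωr t) (s.qr t)‖ ≤ M₀ * M₀ from hcross .ωr .qr]
  · linarith [show ‖cross (angVel r.qd t) (r.qd t)‖ ≤ M₀ * M₀ from hcross .ωd .qd]
  all_goals linarith

end RodBounds

/-- `M` bounds the rod errors and the desired cable forces at time `t`, together with their rates
of change. -/
structure RodC1Bound (M : ℝ) (p : Params) (K : RodGains) (r : Reference) (s : Motion) (J : Set ℝ)
    (t : ℝ) : Prop where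
  ex : C1Bound M (ex r s) J t
  ev : C1Bound M (ev r s) J t
  eωr : C1Bound M (eωr r s) J t
  Ψr : C1Bound M (Ψr r s) J t
  muDes : ∀ j, C1Bound M (muDes p K r s j) J t

theorem exists_rodC1Bound (p : Params) (K : RodGains) (r : Reference) (δ : DistBound) (R : ℝ) :
    ∃ M : ℝ, ∀ C s d J t, IsSolution p K C r s d J → d.BoundedBy δ J → t ∈ J → 0 ≤ t →
      rodErrSq r s t ≤ R → RodC1Bound M p K r s J t := by
  obtain ⟨M₀, hM₀⟩ := exists_c1Bound_rodCoords p K r δ R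
  choose F hF hmuDes using exists_contDiff_muDes p K
  have hcoord (c : RodCoord) : ContDiff ℝ 1 fun z : RodCoord → E3 => z c := contDiff_apply ℝ E3 c
  have heωr : ContDiff ℝ 1 fun z : RodCoord → E3 =>
    z .ωr + cross (z .qr) (cross (z .qr) (z .ωd)) := by fun_prop
  have hΨr : ContDiff ℝ 1 fun z : RodCoord → E3 => 1 - ⟪z .qd, z .qr⟫_ℝ :=
    contDiff_const.sub ((hcoord .qd).inner ℝ (hcoord .qr))
  obtain ⟨M, hex, hev, heω, hΨ, hmu⟩ := ((eventually_c1Bound_comp (hcoord .ex) M₀).and <|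
    (eventually_c1Bound_comp (hcoord .ev) M₀).and <| (eventually_c1Bound_comp heωr M₀).and <|
    (eventually_c1Bound_comp hΨr M₀).and <|
    Filter.eventually_all.2 fun j => eventually_c1Bound_comp (hF j) M₀).exists
  refine ⟨M, fun C s d J t h hd ht ht0 hR => ?_⟩
  have hz := hM₀ C s d J t h hd ht ht0 hR
  refine ⟨hex hz, hev hz, heω hz, hΨ hz, fun j => ?_⟩
  rw [show muDes p K r s j = fun t => F j (rodCoords r s t) from funext (hmuDes j r s)]
  exact hmu j hz

/-! ### Decay of the rod errors -/

theorem C1Bound.norm_sub_le {E : Type*} [NormedAddCommGroup E] [NormedSpace ℝ E] {M a b : ℝ}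
    {f : ℝ → E} {J : Set ℝ} (h : ∀ t ∈ Set.Icc a b, C1Bound M f J t) (hab : a ≤ b)
    (hJ : Set.Icc a b ⊆ J) : ‖f b - f a‖ ≤ M * (b - a) := by
  choose! f' hf' _ hle using h
  exact norm_image_sub_le_of_norm_deriv_le_segment' (fun t ht => (hf' t ht).mono hJ)
    (fun t ht => hle t (Set.Ico_subset_Icc_self ht)) b (Set.right_mem_Icc.2 hab)

/-- At time `t` the rod errors exceed the bounds `D` at most by a margin: this much they may grow
while the cables align with the desired cable forces. -/
structure NearDomain (D : DomainBound) (r : Reference) (s : Motion) (t : ℝ) : Prop where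
  ex_le : ‖ex r s t‖ ≤ D.ex + 1
  ev_le : ‖ev r s t‖ ≤ D.ev + 1
  eωr_le : ‖eωr r s t‖ ≤ D.eωr + 1
  Ψr_le : Ψr r s t ≤ (1 + D.ψr) / 2

theorem NearDomain.rodErrSq_le {D : DomainBound} {r : Reference} {s : Motion} {t : ℝ}
    (h : NearDomain D r s t) (hq : ‖s.qr t‖ = 1) :
    rodErrSq r s t ≤ (D.ex + 1) ^ 2 + (D.ev + 1) ^ 2 + 1 + (D.eωr + 1) ^ 2 := by
  have heqr : ‖eqr r s t‖ ≤ 1 := by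
    simpa only [eqr, r.qd_unit, hq, one_mul] using norm_cross_le (r.qd t) (s.qr t)
  rw [rodErrSq]
  gcongr
  · exact h.ex_le
  · exact h.ev_le
  · exact pow_le_one₀ (norm_nonneg _) heqr
  · exact h.eωr_le

section InDomain

variable {p : Params} {K : RodGains} {r : Reference} {s : Motion} {D : DomainBound}
  {ψ : Fin 2 → ℝ} {J : Set ℝ} {a b M : ℝ}

theorem InDomain.nearDomain (h : InDomain p K r s D ψ J a) : NearDomain D r s a := by
  obtain ⟨hex, hev, heωr, hΨr, -⟩ := h
  exact ⟨by linarith, by linarith, by linarith, by linarith [D.ψr_lt]⟩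

theorem InDomain.nearDomain_of_rodC1Bound (h : InDomain p K r s D ψ J a) (hab : a ≤ b)
    (hJ : Set.Icc a b ⊆ J) (hM : ∀ t ∈ Set.Icc a b, RodC1Bound M p K r s J t)
    (hshort : M * (b - a) ≤ (1 - D.ψr) / 2) : NearDomain D r s b := by
  obtain ⟨hex, hev, heωr, hΨr, -⟩ := h
  have hdex := C1Bound.norm_sub_le (fun t ht => (hM t ht).ex) hab hJ
  have hdev := C1Bound.norm_sub_le (fun t ht => (hM t ht).ev) hab hJ
  have hdeωr := C1Bound.norm_sub_le (fun t ht => (hM t ht).eωr) hab hJ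
  have hdΨr := (le_abs_self _).trans (C1Bound.norm_sub_le (fun t ht => (hM t ht).Ψr) hab hJ)
  have hψr := D.ψr_pos
  constructor
  · linarith [norm_sub_norm_le (ex r s b) (ex r s a)]
  · linarith [norm_sub_norm_le (ev r s b) (ev r s a)]
  · linarith [norm_sub_norm_le (eωr r s b) (eωr r s a)]
  · linarith

end InDomain

/-- A piece `[a, b]` of a solution on `J` that starts with small rod errors and on which the applied
cable forces deviate from the desired ones by at most `1`. -/
structure AlignedRun (p : Params) (K : RodGains) (C : CableGains) (r : Reference) (δ : DistBound)
    (D : DomainBound) (s : Motion) (d : Disturbance) (J : Set ℝ) (a b : ℝ) : Prop where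
  isSolution : IsSolution p K C r s d J
  boundedBy : d.BoundedBy δ J
  start_nonneg : 0 ≤ a
  subset : Set.Icc a b ⊆ J
  norm_muErr_le : ∀ j, ∀ t ∈ Set.Icc a b, ‖muErr p K r s j t‖ ≤ 1
  nearDomain : NearDomain D r s a

/-- Along aligned runs the squared rod errors are at most `β`, a function of the time since the
start of the run. -/
def RodDecay (p : Params) (K : RodGains) (r : Reference) (δ : DistBound) (D : DomainBound)
    (β : ℝ → ℝ) : Prop :=
  ∀ ⦃C s d J a b⦄, AlignedRun p K C r δ D s d J a b →
    ∀ t ∈ Set.Icc a b, rodErrSq r s t ≤ β (t - a)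

theorem exists_envelope_rodPosition (p : Params) (r : Reference) (δ : DistBound)
    (D : DomainBound) :
    ∃ κ > 0, ∀ k, 1 ≤ k → ∀ K : RodGains, K.kx = k ^ 2 → K.kv = 2 * k →
      ∀ C s d J a b, AlignedRun p K C r δ D s d J a b →
        ∀ t ∈ Set.Icc a b, ‖ex r s t‖ ^ 2 + ‖ev r s t‖ ^ 2 ≤ envelope κ k (t - a) := by
  obtain ⟨κ, hκ, hdecay⟩ := exists_envelope_linearLoop (E := E3) (D.ex + 1) (D.ev + 1)
    (p.mr⁻¹ * (1 + 1 + δ.x))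
  refine ⟨κ, hκ, fun k hk K hkx hkv C s d J a b h => ?_⟩
  refine hdecay k hk a b (ex r s) (ev r s)
    (fun t ht => (h.isSolution.hasDerivWithinAt_ex (h.subset ht)).mono h.subset)
    (fun t ht => ⟨p.mr⁻¹ • (muErr p K r s 0 t + muErr p K r s 1 t + d.x t), ?_, ?_⟩)
    h.nearDomain.ex_le h.nearDomain.ev_le
  · rw [norm_smul_of_nonneg (inv_nonneg.2 p.mr_pos.le)]
    have hmr := p.mr_pos
    gcongr
    exact norm_add_le_of_le
      (norm_add_le_of_le (h.norm_muErr_le 0 t ht) (h.norm_muErr_le 1 t ht))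
      (h.boundedBy t (h.subset ht)).1
  · rw [← hkx, ← hkv]
    exact (h.isSolution.hasDerivWithinAt_ev (h.subset ht)).mono h.subset

theorem AlignedRun.norm_rodDist_le {p : Params} {K : RodGains} {C : CableGains} {r : Reference}
    {δ : DistBound} {D : DomainBound} {s : Motion} {d : Disturbance} {J : Set ℝ} {a b t B : ℝ}
    (h : AlignedRun p K C r δ D s d J a b) (ht : t ∈ Set.Icc a b) (hB : ‖angVel r.qd t‖ ≤ B) :
    ‖rodDist p K r s d t‖ ≤ (2 / 3 * p.mr * p.Lr)⁻¹ * (1 + 1 + δ.qr) + 2 * B * B := by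
  have hq := h.isSolution.qr_unit t (h.subset ht)
  have hB0 : 0 ≤ B := (norm_nonneg _).trans hB
  have hmr := p.mr_pos
  have hLr := p.Lr_pos
  refine norm_add_le_of_le ?_ ?_
  · rw [norm_smul_of_nonneg (by positivity)]
    gcongr
    refine norm_add_le_of_le ((norm_cross_le _ _).trans ?_) (h.boundedBy t (h.subset ht)).2.1
    rw [hq, one_mul]
    exact norm_sub_le_of_le (h.norm_muErr_le 1 t ht) (h.norm_muErr_le 0 t ht)
  · rw [norm_smul, norm_mul, Real.norm_two]
    gcongr
    · refine (norm_inner_le_norm _ _).trans ?_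
      rwa [hq, one_mul]
    · refine (norm_cross_le _ _).trans ?_
      rwa [hq, mul_one]

theorem exists_envelope_rodAttitude (p : Params) (r : Reference) (δ : DistBound)
    (D : DomainBound) :
    ∃ κ > 0, ∀ᶠ k in Filter.atTop, ∀ K : RodGains, K.kq = k ^ 2 → K.kω = 2 * k →
      ∀ C s d J a b, AlignedRun p K C r δ D s d J a b →
        ∀ t ∈ Set.Icc a b, ‖eqr r s t‖ ^ 2 + ‖eωr r s t‖ ^ 2 ≤ envelope κ k (t - a) := by
  obtain ⟨B, hB⟩ := r.bounded
  obtain ⟨κ, hκ, hdecay⟩ := exists_envelope_attitudeLoop (ψ := (1 + D.ψr) / 2)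
    (by linarith [D.ψr_lt]) (D.eωr + 1) B ((2 / 3 * p.mr * p.Lr)⁻¹ * (1 + 1 + δ.qr) + 2 * B * B)
  refine ⟨κ, hκ, ?_⟩
  filter_upwards [hdecay] with k hk K hkq hkω C s d J a b h
  have hωd (t : ℝ) (ht : t ∈ Set.Icc a b) : ‖angVel r.qd t‖ ≤ B :=
    (hB t (h.start_nonneg.trans ht.1)).2.2.1
  exact hk a b _ _ _ _
    (h.isSolution.attitudeLoop_rod hkq hkω h.subset hωd
      fun t ht => h.norm_rodDist_le ht (hωd t ht))
    h.nearDomain.eωr_le h.nearDomain.Ψr_le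

theorem exists_rodDecay (p : Params) (r : Reference) (δ : DistBound) (D : DomainBound) {η : ℝ}
    (hη : 0 < η) :
    ∃ K β, Antitone β ∧ (∀ᶠ τ in Filter.atTop, β τ ≤ η) ∧ RodDecay p K r δ D β := by
  obtain ⟨κ₁, hκ₁, hposition⟩ := exists_envelope_rodPosition p r δ D
  obtain ⟨κ₂, hκ₂, hattitude⟩ := exists_envelope_rodAttitude p r δ D
  have hresidual (κ : ℝ) : Filter.Tendsto (fun k : ℝ => κ / k ^ 2) Filter.atTop (nhds 0) :=
    (Filter.tendsto_pow_atTop two_ne_zero).const_div_atTop κ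
  have hsmall := ((hresidual κ₁).add (hresidual κ₂)).eventually_lt_const
    (show 0 + 0 < η by linarith)
  obtain ⟨k, hk, hkη, hattitude⟩ :=
    ((Filter.eventually_ge_atTop 1).and (hsmall.and hattitude)).exists
  have hk0 : 0 < k := one_pos.trans_le hk
  refine ⟨⟨k ^ 2, 2 * k, k ^ 2, 2 * k, by positivity, by positivity, by positivity, by positivity⟩,
    fun τ => envelope κ₁ k τ + envelope κ₂ k τ,
    (envelope_antitone hκ₁ hk0).add (envelope_antitone hκ₂ hk0), ?_, fun C s d J a b h t ht => ?_⟩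
  · exact ((tendsto_envelope_of_time hκ₁ hk0).add
      (tendsto_envelope_of_time hκ₂ hk0)).eventually_le_const hkη
  · rw [rodErrSq]
    linarith [hposition k hk _ rfl rfl C s d J a b h t ht, hattitude _ rfl rfl C s d J a b h t ht]

/-! ### Alignment of the cables -/

/-- The squared norm of the vector of the tracking errors of cable `j`. -/
def cableErrSq (p : Params) (K : RodGains) (r : Reference) (s : Motion) (J : Set ℝ) (j : Fin 2)
    (t : ℝ) : ℝ :=
  ‖eqc p K r s j t‖ ^ 2 + ‖eωc p K r s J j t‖ ^ 2

/-- Within time `τ` from a start in the domain, the squared cable errors drop to `ε` and stay there,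
as long as the desired cable forces have norm at least `m₀` and rate of change at most `M`. -/
def CableAlign (p : Params) (K : RodGains) (C : CableGains) (r : Reference) (δ : DistBound)
    (D : DomainBound) (ψ : Fin 2 → ℝ) (m₀ M τ ε : ℝ) : Prop :=
  ∀ ⦃s d J a b⦄, IsSolution p K C r s d J → d.BoundedBy δ J → UniqueDiffOn ℝ J →
    Set.Icc a b ⊆ J → (∀ j, ∀ t ∈ Set.Icc a b, C1Bound M (muDes p K r s j) J t) →
    (∀ j, ∀ t ∈ Set.Icc a b, m₀ ≤ ‖muDes p K r s j t‖) → InDomain p K r s D ψ J a →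
    ∀ j, ∀ t ∈ Set.Icc a b, a + τ ≤ t → cableErrSq p K r s J j t ≤ ε

theorem exists_cableAlign (p : Params) (K : RodGains) (r : Reference) (δ : DistBound)
    (D : DomainBound) {ψ : Fin 2 → ℝ} (hψ : ∀ j, ψ j < 1) {m₀ τ ε : ℝ} (hm₀ : 0 < m₀) (M : ℝ)
    (hτ : 0 < τ) (hε : 0 < ε) : ∃ C, CableAlign p K C r δ D ψ m₀ M τ ε := by
  choose κ hκ hdecay using fun j => exists_envelope_attitudeLoop (hψ j) (D.eω j) (2 * M / m₀)
    ((p.mQ * p.Lc)⁻¹ * δ.q j)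
  obtain ⟨k, hk, hdecay, hkε⟩ := ((Filter.eventually_gt_atTop 0).and
    ((Filter.eventually_all.2 hdecay).and (Filter.eventually_all.2 fun j =>
      (tendsto_envelope_of_gain (hκ j) hτ).eventually_le_const hε))).exists
  refine ⟨⟨fun _ => k ^ 2, fun _ => 2 * k, fun _ => by positivity, fun _ => by positivity⟩, ?_⟩
  intro s d J a b h hd hJ hsub hmuDes hmuDes_ge ⟨_, _, _, _, hcable⟩ j t ht hτt
  have hmass : 0 < p.mQ * p.Lc := mul_pos p.mQ_pos p.Lc_pos
  have hqd (t : ℝ) (ht : t ∈ Set.Icc a b) : HasDerivWithinAt (qDes p K r s j)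
      (cross (ωDes p K r s J j t) (qDes p K r s j t)) J t ∧
        ‖ωDes p K r s J j t‖ ≤ 2 * M / m₀ := by
    obtain ⟨μ', hμ', -, hM⟩ := hmuDes j t ht
    exact h.hasDerivWithinAt_qDes (hsub ht) (hJ t (hsub ht)) hm₀ hμ' hM (hmuDes_ge j t ht)
  have hdist (t : ℝ) (ht : t ∈ Set.Icc a b) :
      ‖(p.mQ * p.Lc)⁻¹ • d.q j t‖ ≤ (p.mQ * p.Lc)⁻¹ * δ.q j := by
    rw [norm_smul_of_nonneg (inv_nonneg.2 hmass.le)]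
    gcongr
    exact (hd t (hsub ht)).2.2 j
  calc cableErrSq p K r s J j t ≤ envelope (κ j) k (t - a) :=
        hdecay j a b _ _ _ _ (h.attitudeLoop_cable rfl rfl hsub hqd hdist)
          (hcable j).1 (hcable j).2 t ht
    _ ≤ envelope (κ j) k τ := envelope_antitone (hκ j) hk (by linarith)
    _ ≤ ε := hkε j

/-! ### The closed loop -/

/-- A solution on `[t₀, t₁]` of the kind considered in `UniformlyUltimatelyBounded`. -/
structure AdmissibleRun (p : Params) (K : RodGains) (C : CableGains) (r : Reference)
    (δ : DistBound) (D : DomainBound) (ψ : Fin 2 → ℝ) (m₀ : ℝ) (s : Motion) (d : Disturbance)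
    (t₀ t₁ : ℝ) : Prop where
  isSolution : IsSolution p K C r s d (Set.Icc t₀ t₁)
  boundedBy : d.BoundedBy δ (Set.Icc t₀ t₁)
  start_nonneg : 0 ≤ t₀
  start_lt : t₀ < t₁
  le_norm_muDes : ∀ j, ∀ t ∈ Set.Icc t₀ t₁, m₀ ≤ ‖muDes p K r s j t‖
  inDomain : InDomain p K r s D ψ (Set.Icc t₀ t₁) t₀

theorem norm_muErr_le_one {p : Params} {K : RodGains} {r : Reference} {s : Motion} {J : Set ℝ}
    {j : Fin 2} {t M ε : ℝ} (hq : ‖s.q j t‖ = 1) (hμ : muDes p K r s j t ≠ 0)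
    (hM : ‖muDes p K r s j t‖ ≤ M) (herr : cableErrSq p K r s J j t ≤ ε)
    (hε : M ^ 2 * ε ≤ 1) : ‖muErr p K r s j t‖ ≤ 1 := by
  have heqc : ‖eqc p K r s j t‖ ^ 2 ≤ ε := le_trans (le_add_of_nonneg_right (sq_nonneg _)) herr
  rw [← sq_le_one_iff₀ (norm_nonneg _)]
  calc ‖muErr p K r s j t‖ ^ 2
      ≤ (‖muDes p K r s j t‖ * ‖eqc p K r s j t‖) ^ 2 := by
        gcongr
        exact norm_muErr_le hq hμ
    _ = ‖muDes p K r s j t‖ ^ 2 * ‖eqc p K r s j t‖ ^ 2 := mul_pow _ _ _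
    _ ≤ M ^ 2 * ε := by gcongr
    _ ≤ 1 := hε

theorem IsSolution.continuousOn_rodErrSq {p : Params} {K : RodGains} {C : CableGains}
    {r : Reference} {s : Motion} {d : Disturbance} {J : Set ℝ} (h : IsSolution p K C r s d J) :
    ContinuousOn (rodErrSq r s) J := by
  intro t ht
  have hex := (h.hasDerivWithinAt_ex ht).continuousWithinAt
  have hev := (h.hasDerivWithinAt_ev ht).continuousWithinAt
  have heqr := (hasDerivWithinAt_cross (r.hasDerivAt_qd t).hasDerivWithinAt
    (h.qr_kin t ht)).continuousWithinAt
  have heωr := ((h.ωr_diff t ht).hasDerivWithinAt.add (hasDerivWithinAt_cross (h.qr_kin t ht)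
    (hasDerivWithinAt_cross (h.qr_kin t ht)
      (r.hasDerivAt_angVel t).hasDerivWithinAt))).continuousWithinAt
  exact (((hex.norm.pow 2).add (hev.norm.pow 2)).add (heqr.norm.pow 2)).add (heωr.norm.pow 2)

namespace AdmissibleRun

variable {p : Params} {K : RodGains} {C : CableGains} {r : Reference} {δ : DistBound}
  {D : DomainBound} {ψ : Fin 2 → ℝ} {m₀ : ℝ} {s : Motion} {d : Disturbance} {t₀ t₁ : ℝ}
  {M τ ε u : ℝ} {β : ℝ → ℝ}

theorem cableErrSq_le (h : AdmissibleRun p K C r δ D ψ m₀ s d t₀ t₁) (hu : u ≤ t₁)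
    (hM : ∀ t ∈ Set.Icc t₀ u, RodC1Bound M p K r s (Set.Icc t₀ t₁) t)
    (halign : CableAlign p K C r δ D ψ m₀ M τ ε) (j : Fin 2) :
    ∀ t ∈ Set.Icc t₀ u, t₀ + τ ≤ t → cableErrSq p K r s (Set.Icc t₀ t₁) j t ≤ ε := by
  have hsub : Set.Icc t₀ u ⊆ Set.Icc t₀ t₁ := Set.Icc_subset_Icc_right hu
  exact halign h.isSolution h.boundedBy (uniqueDiffOn_Icc h.start_lt) hsub
    (fun j t ht => (hM t ht).muDes j) (fun j t ht => h.le_norm_muDes j t (hsub ht)) h.inDomain j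

theorem alignedRun (h : AdmissibleRun p K C r δ D ψ m₀ s d t₀ t₁) (hτ : 0 ≤ τ)
    (hu : u ∈ Set.Icc (t₀ + τ) t₁)
    (hM : ∀ t ∈ Set.Icc t₀ u, RodC1Bound M p K r s (Set.Icc t₀ t₁) t)
    (halign : CableAlign p K C r δ D ψ m₀ M τ ε) (hMτ : M * τ ≤ (1 - D.ψr) / 2)
    (hε : M ^ 2 * ε ≤ 1) :
    AlignedRun p K C r δ D s d (Set.Icc t₀ t₁) (t₀ + τ) u where
  isSolution := h.isSolution
  boundedBy := h.boundedBy
  start_nonneg := add_nonneg h.start_nonneg hτ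
  subset := Set.Icc_subset_Icc (by linarith) hu.2
  norm_muErr_le j t ht := by
    have htu : t ∈ Set.Icc t₀ u := ⟨by linarith [ht.1], ht.2⟩
    have htJ : t ∈ Set.Icc t₀ t₁ := ⟨htu.1, htu.2.trans hu.2⟩
    obtain ⟨_, -, hmuDes, -⟩ := (hM t htu).muDes j
    exact norm_muErr_le_one (h.isSolution.q_unit j t htJ) (h.isSolution.muDes_ne j t htJ) hmuDes
      (h.cableErrSq_le hu.2 hM halign j t htu ht.1) hε
  nearDomain := h.inDomain.nearDomain_of_rodC1Bound (by linarith)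
    (Set.Icc_subset_Icc_right (hu.1.trans hu.2)) (fun t ht => hM t ⟨ht.1, ht.2.trans hu.1⟩)
    (by rwa [add_sub_cancel_left])

/-- Before `t₀ + τ` the rod errors stay near the domain because little time has passed, and later
because the cables are aligned. -/
theorem rodErrSq_lt {R : ℝ} (h : AdmissibleRun p K C r δ D ψ m₀ s d t₀ t₁) (hτ : 0 ≤ τ)
    (hM : ∀ t ∈ Set.Icc t₀ t₁, rodErrSq r s t ≤ R → RodC1Bound M p K r s (Set.Icc t₀ t₁) t)
    (halign : CableAlign p K C r δ D ψ m₀ M τ ε) (hMτ : M * τ ≤ (1 - D.ψr) / 2)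
    (hε : M ^ 2 * ε ≤ 1) (hdecay : RodDecay p K r δ D β) (hβ : Antitone β) (hβR : β 0 < R)
    (hDR : (D.ex + 1) ^ 2 + (D.ev + 1) ^ 2 + 1 + (D.eωr + 1) ^ 2 < R) :
    ∀ t ∈ Set.Icc t₀ t₁, rodErrSq r s t < R := by
  have hnear (t : ℝ) (ht : t ∈ Set.Icc t₀ t₁) (hD : NearDomain D r s t) : rodErrSq r s t < R :=
    (hD.rodErrSq_le (h.isSolution.qr_unit t ht)).trans_lt hDR
  refine lt_of_continuousOn_of_bootstrap h.isSolution.continuousOn_rodErrSq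
    (hnear t₀ (Set.left_mem_Icc.2 h.start_lt.le) h.inDomain.nearDomain) fun u hu hle => ?_
  have hsub : Set.Icc t₀ u ⊆ Set.Icc t₀ t₁ := Set.Icc_subset_Icc_right hu.2
  have hMu (t : ℝ) (ht : t ∈ Set.Icc t₀ u) := hM t (hsub ht) (hle t ht)
  rcases le_total u (t₀ + τ) with hearly | hlate
  · obtain ⟨_, -, hex, -⟩ := (hMu u (Set.right_mem_Icc.2 hu.1)).ex
    have hM0 : 0 ≤ M := (norm_nonneg _).trans hex
    refine hnear u hu (h.inDomain.nearDomain_of_rodC1Bound hu.1 hsub hMu (le_trans ?_ hMτ))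
    gcongr
    linarith
  · exact (hdecay (h.alignedRun hτ ⟨hlate, hu.2⟩ hMu halign hMτ hε) u ⟨hlate, le_rfl⟩).trans_lt
      ((hβ (sub_nonneg.2 hlate)).trans_lt hβR)

end AdmissibleRun

theorem errNorm_le_of_errSq_le {p : Params} {K : RodGains} {r : Reference} {s : Motion}
    {J : Set ℝ} {t b : ℝ} (hb : 0 ≤ b) (hrod : rodErrSq r s t ≤ b ^ 2 / 3)
    (hcable : ∀ j, cableErrSq p K r s J j t ≤ b ^ 2 / 3) : errNorm p K r s J t ≤ b := by
  refine Real.sqrt_le_iff.2 ⟨hb, ?_⟩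
  change rodErrSq r s t + ∑ j, cableErrSq p K r s J j t ≤ b ^ 2
  rw [Fin.sum_univ_two]
  linarith [hcable 0, hcable 1]

theorem RodDecay.exists_uniformlyUltimatelyBounded {p : Params} {K : RodGains} {r : Reference}
    {δ : DistBound} {D : DomainBound} {β : ℝ → ℝ} (hdecay : RodDecay p K r δ D β)
    (hβ : Antitone β) {b : ℝ} (hb : 0 < b) (hβb : ∀ᶠ τ in Filter.atTop, β τ ≤ b ^ 2 / 3)
    {ψ : Fin 2 → ℝ} (hψ : ∀ j, ψ j < 1) {m₀ : ℝ} (hm₀ : 0 < m₀) :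
    ∃ C, UniformlyUltimatelyBounded p K C r δ D ψ m₀ b := by
  obtain ⟨R, hR⟩ := exists_gt (max (β 0) ((D.ex + 1) ^ 2 + (D.ev + 1) ^ 2 + 1 + (D.eωr + 1) ^ 2))
  obtain ⟨hβR, hDR⟩ := max_lt_iff.1 hR
  obtain ⟨M, hM⟩ := exists_rodC1Bound p K r δ R
  obtain ⟨τ, hτ, hMτ⟩ := exists_pos_mul_lt (half_pos (sub_pos.2 D.ψr_lt)) M
  obtain ⟨ε₁, hε₁, hMε₁⟩ := exists_pos_mul_lt one_pos (M ^ 2)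
  obtain ⟨ε, hε, hεε₁, hεb⟩ : ∃ ε > 0, ε ≤ ε₁ ∧ ε ≤ b ^ 2 / 3 :=
    ⟨min ε₁ (b ^ 2 / 3), lt_min hε₁ (by positivity), min_le_left _ _, min_le_right _ _⟩
  have hMε : M ^ 2 * ε ≤ 1 := (mul_le_mul_of_nonneg_left hεε₁ (sq_nonneg M)).trans hMε₁.le
  obtain ⟨C, halign⟩ := exists_cableAlign p K r δ D hψ hm₀ M hτ hε
  obtain ⟨T, hT, hT0⟩ := (hβb.and (Filter.eventually_ge_atTop 0)).exists
  refine ⟨C, τ + T, by positivity, fun t₀ t₁ s d ht₀ hs hd hm hinit t ht => ?_⟩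
  have h : AdmissibleRun p K C r δ D ψ m₀ s d t₀ t₁ :=
    ⟨hs, hd, ht₀, by linarith [ht.1, ht.2], hm, hinit⟩
  have hMR (t : ℝ) (ht : t ∈ Set.Icc t₀ t₁) := hM C s d _ t hs hd ht (ht₀.trans ht.1)
  have hbox := h.rodErrSq_lt hτ.le hMR halign hMτ.le hMε hdecay hβ hβR hDR
  have hMt (t : ℝ) (ht : t ∈ Set.Icc t₀ t₁) := hMR t ht (hbox t ht).le
  have htτ : t ∈ Set.Icc (t₀ + τ) t₁ := ⟨by linarith [ht.1], ht.2⟩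
  have htJ : t ∈ Set.Icc t₀ t₁ := ⟨by linarith [htτ.1], ht.2⟩
  have haligned := h.alignedRun hτ.le ⟨htτ.1.trans htτ.2, le_rfl⟩ hMt halign hMτ.le hMε
  refine errNorm_le_of_errSq_le hb.le ?_ fun j =>
    (h.cableErrSq_le le_rfl hMt halign j t htJ htτ.1).trans hεb
  exact ((hdecay haligned t htτ).trans (hβ (by linarith [ht.1]))).trans hT

end RodTransport

end

open RodTransport in
theorem theorem5p1_general (p : Params) (r : Reference) (δ : DistBound) (D : DomainBound) {b : ℝ}
    (hb : 0 < b) :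
    ∃ K : RodGains, ∀ ψ : Fin 2 → ℝ, (∀ j, ψ j < 1) → ∀ m₀ : ℝ, 0 < m₀ → ∃ C : CableGains,
      UniformlyUltimatelyBounded p K C r δ D ψ m₀ b := by
  obtain ⟨K, β, hβ, hβb, hdecay⟩ := exists_rodDecay p r δ D (η := b ^ 2 / 3) (by positivity)
  exact ⟨K, fun ψ hψ m₀ hm₀ => hdecay.exists_uniformlyUltimatelyBounded hβ hb hβb hψ hm₀⟩

open RodTransport in
theorem theorem5p1 (p : Params) (r : Reference) (δ : DistBound) (D : DomainBound) :
    ∃ αmax : ℝ, 0 < αmax ∧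
      ∀ ψ : Fin 2 → ℝ, (∀ j, 0 < ψ j ∧ ψ j < 1) → cableSize ψ < αmax →
        ∀ b : ℝ, 0 < b → ∃ K : RodGains, ∀ m₀ : ℝ, 0 < m₀ → ∃ C : CableGains,
          UniformlyUltimatelyBounded p K C r δ D ψ m₀ b := by
  refine ⟨1, one_pos, fun ψ hψ _ b hb => ?_⟩
  obtain ⟨K, hK⟩ := theorem5p1_general p r δ D hb
  exact ⟨K, hK ψ fun j => (hψ j).2⟩
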